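/- **Setting.** A dataset $\mathbf{x}$ is a finite multiset of subsets of $[d]$ (one subset per user). Two datasets are neighbors if one arises from the other by adding or deleting one user. Let $h_j(\mathbf{x})$ be the number of users whose set contains $j$. Order $[d]$ by decreasing count, breaking ties by a fixed data-independent order, and let $h_{(1)}\ge h_{(2)}\ge\cdots\ge h_{(d)}$ be the sorted counts, with $h_{(d+1)}=0$. A randomized algorithm $\mathcal{M}$ is $(\alpha,\beta)$-differentially private (DP) if $\Pr[\mathcal{M}(\mathbf{x})\in S]\le e^{\alpha}\Pr[\mathcal{M}(\mathbf{x}')\in S]+\beta$ for all neighbors $\mathbf{x},\mathbf{x}'$ and all outcome sets $S$. $\mathrm{Gumbel}(b)$ is the distribution on $\mathbb{R}$ with density $\frac1b\exp(-(z/b+e^{-z/b}))$. **Limited domain algorithm** $\mathrm{LD}^{k,\bar k}$ (parameters $\varepsilon,\delta>0$; unrestricted sensitivity; $k\le \bar k\le d$). Put $v_\bot=h_{(\bar k+1)}+1+\ln(\bar k/\delta)/\varepsilon+\mathrm{Gumbel}(1/\varepsilon)$, and for each of the top $\bar k$ elements $i$ put $v_i=h_i+\mathrm{Gumbel}(1/\varepsilon)$,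 all noise variables being independent. List the elements with $v_i>v_\bot$ in decreasing order of $v_i$. If there are fewer than $k$ of them, return this list followed by $\bot$; otherwise return its first $k$ entries. **Optimal threshold algorithm** (parameters $1\le k\le\bar d\le d$ and $\varepsilon,\delta>0$). Choose $\bar k\in\{k,\dots,\bar d\}$ by the exponential mechanism with quality score $-(h_{(i)}+\ln(i/\delta)/\varepsilon)$, that is, let $\bar k$ be the $i\in\{k,\dots,\bar d\}$ that minimizes $h_{(i)}+\ln(i/\delta)/\varepsilon-G_i$ with $G_i\sim\mathrm{Gumbel}(1/\varepsilon)$ independent. Then, with fresh noise, return the output of $\mathrm{LD}^{k-1,\bar k}$ with parameters $\varepsilon,\delta$. **Lemma.** For all $1\le k\le\bar d\le d$, all $\varepsilon,\delta>0$ and all $\delta'\ge0$, the optimal threshold algorithm is $(\varepsilon',\delta+\delta')$-DP, where $$\varepsilon'=\min\left\{k\varepsilon,\; k\varepsilon\,\frac{e^{\varepsilon}-1}{e^{\varepsilon}+1}+\varepsilon\sqrt{2k\ln(1/\delta')},\; \frac{k\varepsilon^2}{2}+\varepsilon\sqrt{\tfrac12 k\ln(1/\delta')}\right\}.$$ For $\delta'=0$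 this is read as $\varepsilon'=k\varepsilon$; for $\delta'>1$, where the claim is trivial, the square roots are read as $0$. -/

import Mathlib

open MeasureTheory

namespace TopKDP

noncomputable section

/-- A dataset over the domain `[d]` (here `Fin d`): each user contributes a subset of `[d]`. -/
abbrev Dataset (d : ℕ) : Type := Multiset (Finset (Fin d))

/-- Neighbors differ in the addition or deletion of one user. -/
def Neighbors {d : ℕ} (x y : Dataset d) : Prop :=
  ∃ u : Finset (Fin d), x = u ::ₘ y ∨ y = u ::ₘ x

/-- The number of users that have element `j`. -/
def histogram {d : ℕ} (x : Dataset d) (j : Fin d) : ℕ :=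
  x.countP (fun u => j ∈ u)

/-- A randomized algorithm is a function of the dataset and of a random seed with law `P`. It is
`(ε, δ)`-differentially private if `Pr[M x ∈ S] ≤ exp ε * Pr[M y ∈ S] + δ` for all neighbors
`x, y` and all outcome sets `S`. -/
def IsDifferentiallyPrivate {d : ℕ} {Ω Y : Type*} [MeasurableSpace Ω] (P : Measure Ω)
    (M : Dataset d → Ω → Y) (ε δ : ℝ) : Prop :=
  ∀ x y : Dataset d, Neighbors x y → ∀ S : Set Y,
    P {ω | M x ω ∈ S} ≤
      ENNReal.ofReal (Real.exp ε) * P {ω | M y ω ∈ S} + ENNReal.ofReal δ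

/-- The Gumbel distribution with scale `b`, through its density. -/
def gumbel (b : ℝ) : Measure ℝ :=
  volume.withDensity fun z =>
    ENNReal.ofReal (1 / b * Real.exp (-(z / b + Real.exp (-z / b))))

/-- The elements of the domain in order of decreasing count; ties are broken by the fixed,
data-independent priority order `τ`. -/
def ranking {d : ℕ} (τ : Equiv.Perm (Fin d)) (h : Fin d → ℕ) : List (Fin d) :=
  (List.finRange d).insertionSort fun a b => h b < h a ∨ (h a = h b ∧ τ a ≤ τ b)

/-- The `j`-th largest count (`j ≥ 1`), with value `0` for `j > d`. -/
def orderedCount {d : ℕ} (τ : Equiv.Perm (Fin d)) (h : Fin d → ℕ) (j : ℕ) : ℕ :=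
  ((ranking τ h).map h).getD (j - 1) 0

/-- The threshold count of `⊥` in the limited domain algorithm. -/
def botCount {d : ℕ} (τ : Equiv.Perm (Fin d)) (Δ kbar : ℕ) (ε δ : ℝ) (h : Fin d → ℕ) : ℝ :=
  (orderedCount τ h (kbar + 1) : ℝ) + 1 + Real.log (((min Δ kbar : ℕ) : ℝ) / δ) / ε

/-- The noisy count of an element, or of `⊥` (written `none`), where `g` is the noise. -/
def noisyCount {d : ℕ} (τ : Equiv.Perm (Fin d)) (Δ kbar : ℕ) (ε δ : ℝ) (h : Fin d → ℕ)
    (g : Option (Fin d) → ℝ) : Option (Fin d) → ℝ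
  | none => botCount τ Δ kbar ε δ h + g none
  | some i => (h i : ℝ) + g (some i)

/-- The top-`kbar` elements and `⊥`, in order of decreasing noisy count. -/
def noisyRanking {d : ℕ} (τ : Equiv.Perm (Fin d)) (Δ kbar : ℕ) (ε δ : ℝ) (h : Fin d → ℕ)
    (g : Option (Fin d) → ℝ) : List (Option (Fin d)) :=
  (none :: ((ranking τ h).take kbar).map some).insertionSort fun a b =>
    noisyCount τ Δ kbar ε δ h g b ≤ noisyCount τ Δ kbar ε δ h g a

/-- The output of the top-`k` limited domain algorithm with cutoff `kbar`, sensitivity bound `Δ`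
and noise `g`: the noisy ranking up to and including `⊥` if fewer than `k` elements precede `⊥`,
and the first `k` elements otherwise. -/
def limitedDomain {d : ℕ} (τ : Equiv.Perm (Fin d)) (Δ k kbar : ℕ) (ε δ : ℝ) (h : Fin d → ℕ)
    (g : Option (Fin d) → ℝ) : List (Option (Fin d)) :=
  let above := (noisyRanking τ Δ kbar ε δ h g).takeWhile Option.isSome
  if above.length < k then above ++ [none] else above.take k

/-- The exponential mechanism with quality score `-(h_(i) + ln(i/δ)/ε)` on the candidate cutoffs
`i ∈ [k, dbar]`, run through Gumbel noise: the score plus noise `g i` is maximized, that is,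
`h_(i) + ln(i/δ)/ε - g i` is minimized. Ties have probability zero; the least minimizer is
taken. -/
def noisyCutoff {d : ℕ} (τ : Equiv.Perm (Fin d)) (k dbar : ℕ) (ε δ : ℝ) (h : Fin d → ℕ)
    (g : Finset.Icc k dbar → ℝ) : ℕ :=
  let v : Finset.Icc k dbar → ℝ := fun i =>
    (orderedCount τ h i : ℝ) + Real.log (((i : ℕ) : ℝ) / δ) / ε - g i
  sInf {i : ℕ | ∃ hi : i ∈ Finset.Icc k dbar, ∀ j : Finset.Icc k dbar, v ⟨i, hi⟩ ≤ v j}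

/-- Independent Gumbel noise of scale `1 / ε`: one variable for each candidate cutoff, and one for
each element of the domain and for `⊥`. -/
def noiseLaw (d k dbar : ℕ) (ε : ℝ) :
    Measure ((Finset.Icc k dbar → ℝ) × (Option (Fin d) → ℝ)) :=
  (Measure.pi fun _ : Finset.Icc k dbar => gumbel (1 / ε)).prod
    (Measure.pi fun _ : Option (Fin d) => gumbel (1 / ε))

/-- The optimal threshold algorithm for unrestricted sensitivity (`Δ = d`): choose the cutoff
privately, then run the top-`(k - 1)` limited domain algorithm with this cutoff and fresh noise. -/
def optimalThreshold {d : ℕ} (τ : Equiv.Perm (Fin d)) (k dbar : ℕ) (ε δ : ℝ) (h : Fin d → ℕ)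
    (ω : (Finset.Icc k dbar → ℝ) × (Option (Fin d) → ℝ)) : List (Option (Fin d)) :=
  limitedDomain τ d (k - 1) (noisyCutoff τ k dbar ε δ h ω.1) ε δ h ω.2

/-- The privacy parameter after `k` steps. For `δ' = 0` we have `log (1 / δ') = +∞`, so that the
minimum is its first entry. -/
def composedEps (k : ℕ) (ε δ' : ℝ) : ℝ :=
  if δ' = 0 then k * ε
  else min (k * ε)
    (min
      (k * ε * ((Real.exp ε - 1) / (Real.exp ε + 1)) + ε * √(2 * k * Real.log (1 / δ')))
      (k * ε ^ 2 / 2 + ε * √(1 / 2 * k * Real.log (1 / δ'))))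

end

end TopKDP

/-! If G is Gumbel of scale 1/ε, then exp(-ε(s+G)) is an exponential clock of rate exp(εs), and
larger noisy scores ring earlier. By memorylessness, sorting noisy scores is the same as drawing
without replacement with probabilities proportional to exp(εs). So the algorithm is a chain of at
most k exponential mechanisms: one draws the cutoff m, and at most k-1 draw elements of the top-m
set together with ⊥, stopping at ⊥ (`lintegral_peel`, `noiseLaw_optimalThreshold`).

Adding or deleting one user moves all scores in the same direction by at most 1. Hence the privacy
loss of each draw lies in an interval of length ε, not merely in [-ε, ε]. Hoeffding's lemma on this
interval, with the bound ε tanh(ε/2) on the mean loss, controls the moment generating function of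
one step (`RangeBounded.sum_exp_loss_le`). Bounds of the form P(S) ≤ exp(t) Q(S) + exp(-lt) K, valid
for every t, compose through adaptive steps, because the loss of a step merely shifts t
(`RangeBounded.sum_gibbs_mul_le`, `peel_gibbs_le`). The optimal l yields a t below both advanced
composition bounds; the bound kε is ordinary pure composition.

The remaining difficulty is that, for a fixed cutoff m, neighbors may have different top-m sets.
These have equal size, so a permutation fixing their common elements matches them, and matched
counts still move in one direction by at most 1 (`count_le_count_map`). A moved element has count at
most h_(m+1) + 1, so the offset ln(m/δ)/ε of ⊥ lets it precede ⊥ with probability at most δ/m; a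
union bound costs δ in total (`peel_bad_le`). Outputs without moved elements are unaffected by the
relabelling, so both runs can be compared on one domain (`CountsWithin.exists_coupling`). -/

namespace TopKDP

/-! ### Moments of the privacy loss: two analytic inequalities -/

/-- Hoeffding's lemma for a finitely supported distribution. -/
theorem sum_mul_exp_le_exp_mean {ι : Type*} (A : Finset ι) (p X : ι → ℝ)
    (hp : ∀ i ∈ A, 0 ≤ p i) (hsum : ∑ i ∈ A, p i = 1) (a b l : ℝ)
    (hX : ∀ i ∈ A, X i ∈ Set.Icc a b) :
    ∑ i ∈ A, p i * Real.exp (l * X i) ≤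
      Real.exp (l * ∑ i ∈ A, p i * X i + l ^ 2 * (b - a) ^ 2 / 8) := by
  -- The weights become a discrete measure on the full σ-algebra, so that every function is
  -- measurable and the sub-Gaussian form of Hoeffding's lemma applies.
  let _ : MeasurableSpace ι := ⊤
  let μ : Measure ι := ∑ i ∈ A, ENNReal.ofReal (p i) • Measure.dirac i
  have hint : ∀ f : ι → ℝ, ∫ x, f x ∂μ = ∑ i ∈ A, p i * f i := by
    intro f
    rw [integral_finsetSum_measure]
    · refine Finset.sum_congr rfl fun i hi => ?_
      rw [integral_smul_measure, integral_dirac, ENNReal.toReal_ofReal (hp i hi), smul_eq_mul]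
    · intro i _
      exact (integrable_dirac (by simp)).smul_measure ENNReal.ofReal_ne_top
  have hμ : IsProbabilityMeasure μ := by
    constructor
    simp only [μ, Measure.coe_finsetSum, Finset.sum_apply, Measure.smul_apply, measure_univ,
      smul_eq_mul, mul_one]
    rw [← ENNReal.ofReal_sum_of_nonneg hp, hsum, ENNReal.ofReal_one]
  have hae : ∀ᵐ x ∂μ, X x ∈ Set.Icc a b := by
    rw [ae_iff]
    simp only [μ, Measure.coe_finsetSum, Finset.sum_apply, Measure.smul_apply, smul_eq_mul]
    refine Finset.sum_eq_zero fun i hi => ?_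
    rw [Measure.dirac_apply' _ MeasurableSpace.measurableSet_top,
      Set.indicator_of_notMem (by simpa using hX i hi), mul_zero]
  have h := (ProbabilityTheory.hasSubgaussianMGF_of_mem_Icc (μ := μ) (X := X)
    measurable_from_top.aemeasurable hae).mgf_le l
  rw [ProbabilityTheory.mgf, hint, hint] at h
  have hsplit : ∀ i, p i * Real.exp (l * X i) =
      Real.exp (l * ∑ j ∈ A, p j * X j) *
        (p i * Real.exp (l * (X i - ∑ j ∈ A, p j * X j))) := by
    intro i
    rw [mul_left_comm, ← Real.exp_add]
    ring_nf
  rw [Finset.sum_congr rfl fun i _ => hsplit i, ← Finset.mul_sum, Real.exp_add]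
  refine mul_le_mul_of_nonneg_left (h.trans (le_of_eq ?_)) (Real.exp_pos _).le
  congr 1
  simp only [NNReal.coe_pow, NNReal.coe_div, coe_nnnorm, NNReal.coe_ofNat, Real.norm_eq_abs]
  rw [div_pow, sq_abs]
  ring

/-- The mean privacy loss of an `ε`-differentially private step is at most `ε tanh (ε / 2)`. -/
theorem add_mul_exp_neg_le {e x : ℝ} (he : 0 < e) (h1 : -e ≤ x) (h2 : x ≤ e) :
    x + 2 * e / (Real.exp e - Real.exp (-e)) * Real.exp (-x) ≤
      e * ((Real.exp e - 1) / (Real.exp e + 1)) + 2 * e / (Real.exp e - Real.exp (-e)) := by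
  have hlt : Real.exp (-e) < Real.exp e := Real.exp_lt_exp.2 (by linarith)
  have hd : 0 < Real.exp e - Real.exp (-e) := by linarith
  -- On [-e, e] the convex function exp(-x) lies below its chord. The factor 2e/(exp e - exp(-e)) is
  -- the reciprocal of the absolute slope of the chord, so the terms linear in x cancel and a
  -- constant remains.
  have hconv := convexOn_exp.2 (Set.mem_univ (-e)) (Set.mem_univ e)
    (show 0 ≤ (e + x) / (2 * e) by apply div_nonneg <;> linarith)
    (show 0 ≤ (e - x) / (2 * e) by apply div_nonneg <;> linarith) (by field_simp; ring)
  simp only [smul_eq_mul] at hconv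
  have hx : (e + x) / (2 * e) * -e + (e - x) / (2 * e) * e = -x := by field_simp; ring
  rw [hx] at hconv
  have hm := mul_le_mul_of_nonneg_left hconv
    (show 0 ≤ 2 * e / (Real.exp e - Real.exp (-e)) by positivity)
  refine (add_le_add_right hm x).trans (le_of_eq ?_)
  rw [Real.exp_neg] at hd ⊢
  have hE := Real.exp_pos e
  have h1E : 1 < Real.exp e := Real.one_lt_exp_iff.2 he
  generalize Real.exp e = E at *
  have h3 : E - E⁻¹ = (E - 1) * (E + 1) / E := by field_simp; ring
  have h4 : E - 1 ≠ 0 := by linarith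
  have h5 : E + 1 ≠ 0 := by linarith
  rw [h3]
  field_simp
  ring

/-! ### Exponential mechanisms with range-bounded weights -/

/-- The choice probabilities of the exponential mechanism with weights `w` on `A`. -/
noncomputable def gibbs {ι : Type*} (w : ι → ℝ) (A : Finset ι) (a : ι) : ℝ :=
  w a / ∑ b ∈ A, w b

section Gibbs

variable {ι : Type*} {A : Finset ι} {w u : ι → ℝ}

theorem gibbs_pos (hw : ∀ a, 0 < w a) {a : ι} (ha : a ∈ A) : 0 < gibbs w A a :=
  div_pos (hw a) (Finset.sum_pos (fun b _ => hw b) ⟨a, ha⟩)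

theorem gibbs_nonneg (hw : ∀ a, 0 < w a) (a : ι) : 0 ≤ gibbs w A a :=
  div_nonneg (hw a).le (Finset.sum_nonneg fun b _ => (hw b).le)

theorem sum_gibbs (hw : ∀ a, 0 < w a) (hA : A.Nonempty) : ∑ a ∈ A, gibbs w A a = 1 := by
  simp only [gibbs]
  rw [← Finset.sum_div, div_self (Finset.sum_pos (fun b _ => hw b) hA).ne']

/-- Weights on a common domain whose ratios lie in an interval `[exp c, exp (c + e)]`. -/
def RangeBounded (A : Finset ι) (w u : ι → ℝ) (c e : ℝ) : Prop :=
  ∀ a ∈ A, Real.exp c * w a ≤ u a ∧ u a ≤ Real.exp (c + e) * w a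

theorem RangeBounded.mono {B : Finset ι} {c e : ℝ} (h : RangeBounded A w u c e) (hB : B ⊆ A) :
    RangeBounded B w u c e :=
  fun a ha => h a (hB ha)

/-- The loss at `a` is the log ratio of the normalizing sums, which does not depend on `a`, minus
log(u a / w a), which varies in an interval of length `e`. This length gives the constant 1/8 · e²
in Hoeffding's lemma. -/
theorem RangeBounded.log_loss_mem {c e : ℝ} (hw : ∀ a, 0 < w a) (hu : ∀ a, 0 < u a)
    (h : RangeBounded A w u c e) {a : ι} (ha : a ∈ A) :
    Real.log (gibbs w A a / gibbs u A a) ∈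
      Set.Icc (Real.log ((∑ b ∈ A, u b) / ∑ b ∈ A, w b) - (c + e))
        (Real.log ((∑ b ∈ A, u b) / ∑ b ∈ A, w b) - c) := by
  have hW : 0 < ∑ b ∈ A, w b := Finset.sum_pos (fun b _ => hw b) ⟨a, ha⟩
  have hU : 0 < ∑ b ∈ A, u b := Finset.sum_pos (fun b _ => hu b) ⟨a, ha⟩
  have hr : gibbs w A a / gibbs u A a = ((∑ b ∈ A, u b) / ∑ b ∈ A, w b) / (u a / w a) := by
    have := hw a
    have := hu a
    simp only [gibbs]
    field_simp
  rw [hr, Real.log_div (div_pos hU hW).ne' (div_pos (hu a) (hw a)).ne']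
  have h1 : c ≤ Real.log (u a / w a) :=
    (Real.le_log_iff_exp_le (div_pos (hu a) (hw a))).2 ((le_div_iff₀ (hw a)).2 (h a ha).1)
  have h2 : Real.log (u a / w a) ≤ c + e :=
    (Real.log_le_iff_le_exp (div_pos (hu a) (hw a))).2 ((div_le_iff₀ (hw a)).2 (h a ha).2)
  constructor <;> linarith

/-- The normalizing sums inherit the termwise ratio bounds. Together with the previous interval this
puts the loss in [-e, e], as needed for the mean. -/
theorem RangeBounded.log_sum_mem {c e : ℝ} (hw : ∀ a, 0 < w a) (hu : ∀ a, 0 < u a)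
    (h : RangeBounded A w u c e) (hA : A.Nonempty) :
    Real.log ((∑ b ∈ A, u b) / ∑ b ∈ A, w b) ∈ Set.Icc c (c + e) := by
  have hW : 0 < ∑ b ∈ A, w b := Finset.sum_pos (fun b _ => hw b) hA
  have hU : 0 < ∑ b ∈ A, u b := Finset.sum_pos (fun b _ => hu b) hA
  constructor
  · rw [Real.le_log_iff_exp_le (div_pos hU hW), le_div_iff₀ hW, Finset.mul_sum]
    exact Finset.sum_le_sum fun a ha => (h a ha).1
  · rw [Real.log_le_iff_le_exp (div_pos hU hW), div_le_iff₀ hW, Finset.mul_sum]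
    exact Finset.sum_le_sum fun a ha => (h a ha).2

/-- The moment generating function of the privacy loss of a range-bounded step. -/
theorem RangeBounded.sum_exp_loss_le {c e : ℝ} (he : 0 < e) (hw : ∀ a, 0 < w a)
    (hu : ∀ a, 0 < u a) (h : RangeBounded A w u c e) (hA : A.Nonempty) {l : ℝ} (hl : 0 ≤ l) :
    ∑ a ∈ A, gibbs w A a * Real.exp (l * Real.log (gibbs w A a / gibbs u A a)) ≤
      Real.exp (l * (e * ((Real.exp e - 1) / (Real.exp e + 1))) + l ^ 2 * e ^ 2 / 8) := by
  set X : ι → ℝ := fun a => Real.log (gibbs w A a / gibbs u A a) with hXdef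
  have hmem := fun a (ha : a ∈ A) => h.log_loss_mem hw hu ha
  have hR := h.log_sum_mem hw hu hA
  have h1 := sum_mul_exp_le_exp_mean A (gibbs w A) X (fun a _ => gibbs_nonneg hw a)
    (sum_gibbs hw hA) _ _ l hmem
  refine h1.trans (Real.exp_le_exp.2 ?_)
  have hmean : ∑ a ∈ A, gibbs w A a * X a ≤ e * ((Real.exp e - 1) / (Real.exp e + 1)) := by
    set C := 2 * e / (Real.exp e - Real.exp (-e)) with hC
    -- exp(-X) is the likelihood ratio of the second law to the first. As its mean is 1, averaging
    -- the pointwise chord bound leaves a bound on the mean of X alone.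
    have hE : ∑ a ∈ A, gibbs w A a * Real.exp (-X a) = 1 := by
      rw [← sum_gibbs hu hA]
      refine Finset.sum_congr rfl fun a ha => ?_
      have h1 := gibbs_pos hw ha
      have h2 := gibbs_pos hu ha
      rw [Real.exp_neg, hXdef, Real.exp_log (div_pos h1 h2)]
      field_simp
    have hpt : ∑ a ∈ A, gibbs w A a * (X a + C * Real.exp (-X a)) ≤
        ∑ a ∈ A, gibbs w A a * (e * ((Real.exp e - 1) / (Real.exp e + 1)) + C) := by
      refine Finset.sum_le_sum fun a ha => mul_le_mul_of_nonneg_left ?_ (gibbs_nonneg hw a)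
      have := hmem a ha
      refine add_mul_exp_neg_le he ?_ ?_
      · linarith [this.1, hR.1]
      · linarith [this.2, hR.2]
    have hexp : ∑ a ∈ A, gibbs w A a * (X a + C * Real.exp (-X a)) =
        ∑ a ∈ A, gibbs w A a * X a + C * ∑ a ∈ A, gibbs w A a * Real.exp (-X a) := by
      rw [Finset.mul_sum, ← Finset.sum_add_distrib]
      exact Finset.sum_congr rfl fun a _ => by ring
    rw [hexp, hE, ← Finset.sum_mul, sum_gibbs hw hA] at hpt
    linarith
  have := mul_le_mul_of_nonneg_left hmean hl
  have hb : Real.log ((∑ b ∈ A, u b) / ∑ b ∈ A, w b) - c -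
      (Real.log ((∑ b ∈ A, u b) / ∑ b ∈ A, w b) - (c + e)) = e := by ring
  rw [hb]
  linarith

/-- One step of composition, pure privacy. -/
theorem RangeBounded.gibbs_le {c e : ℝ} (hw : ∀ a, 0 < w a)
    (hu : ∀ a, 0 < u a) (h : RangeBounded A w u c e) {a : ι} (ha : a ∈ A) :
    gibbs w A a ≤ Real.exp e * gibbs u A a := by
  have h1 := h.log_loss_mem hw hu ha
  have h2 := h.log_sum_mem hw hu ⟨a, ha⟩
  have hp := gibbs_pos hw ha
  have hq := gibbs_pos hu ha
  rw [← div_le_iff₀ hq, ← Real.log_le_iff_le_exp (div_pos hp hq)]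
  linarith [h1.2, h2.2]

/-- One step of composition: a tail bound for the continuations, uniform in the threshold `t`,
gives one for the step followed by its continuations. -/
theorem RangeBounded.sum_gibbs_mul_le {c e : ℝ} (he : 0 < e) (hw : ∀ a, 0 < w a)
    (hu : ∀ a, 0 < u a) (h : RangeBounded A w u c e) (hA : A.Nonempty) {l : ℝ} (hl : 0 ≤ l)
    {K : ℝ} (hK : 0 ≤ K) {f g : ι → ℝ}
    (hfg : ∀ a ∈ A, ∀ t : ℝ, f a ≤ Real.exp t * g a + Real.exp (-l * t) * K) (t : ℝ) :
    ∑ a ∈ A, gibbs w A a * f a ≤ Real.exp t * ∑ a ∈ A, gibbs u A a * g a +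
      Real.exp (-l * t) * (K * Real.exp (l * (e * ((Real.exp e - 1) / (Real.exp e + 1))) +
        l ^ 2 * e ^ 2 / 8)) := by
  have hstep : ∀ a ∈ A, gibbs w A a * f a ≤ Real.exp t * (gibbs u A a * g a) +
      Real.exp (-l * t) * K *
        (gibbs w A a * Real.exp (l * Real.log (gibbs w A a / gibbs u A a))) := by
    intro a ha
    have hp := gibbs_pos hw ha
    have hq := gibbs_pos hu ha
    -- The threshold is shifted by the loss already incurred at `a`. The shift turns the first law
    -- into the second in the main term and leaves the factor exp(l · loss) in the tail term.
    refine (mul_le_mul_of_nonneg_left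
      (hfg a ha (t - Real.log (gibbs w A a / gibbs u A a))) hp.le).trans (le_of_eq ?_)
    have h1 : Real.exp (t - Real.log (gibbs w A a / gibbs u A a)) =
        Real.exp t * (gibbs u A a / gibbs w A a) := by
      rw [Real.exp_sub, Real.exp_log (div_pos hp hq)]
      field_simp
    have h2 : Real.exp (-l * (t - Real.log (gibbs w A a / gibbs u A a))) =
        Real.exp (-l * t) * Real.exp (l * Real.log (gibbs w A a / gibbs u A a)) := by
      rw [← Real.exp_add]
      ring_nf
    rw [h1, h2]
    field_simp
  refine (Finset.sum_le_sum hstep).trans ?_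
  rw [Finset.sum_add_distrib, ← Finset.mul_sum, ← Finset.mul_sum]
  refine add_le_add_right ?_ _
  rw [← mul_assoc]
  exact mul_le_mul_of_nonneg_left (h.sum_exp_loss_le he hw hu hA hl)
    (mul_nonneg (Real.exp_pos _).le hK)

end Gibbs

/-! ### Drawing without replacement up to a stopping element -/

section Peel

variable {ι : Type*} [DecidableEq ι]

/-- Draw elements of `A` without replacement, with probabilities `p`, until `z` or `n` elements
are drawn; the mean of `φ` over the list of drawn elements. -/
def peel (p : Finset ι → ι → ℝ) (z : ι) : ℕ → Finset ι → (List ι → ℝ) → ℝ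
  | 0, _, φ => φ []
  | n + 1, A, φ => ∑ a ∈ A, p A a *
      if a = z then φ [z] else peel p z n (A.erase a) (fun l => φ (a :: l))

variable {p : Finset ι → ι → ℝ} {z : ι}

/-- Restricting the comparison to lists that can actually be drawn matters later, when a bad entry
of a list must be known to lie in the top set. -/
theorem peel_mono (hp : ∀ A a, 0 ≤ p A a) (n : ℕ) (A : Finset ι) {φ ψ : List ι → ℝ}
    (h : ∀ l, (∀ a ∈ l, a = z ∨ a ∈ A) → φ l ≤ ψ l) : peel p z n A φ ≤ peel p z n A ψ := by
  induction n generalizing A φ ψ with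
  | zero => exact h _ (by simp)
  | succ n ih =>
    refine Finset.sum_le_sum fun a ha => mul_le_mul_of_nonneg_left ?_ (hp A a)
    split_ifs with haz
    · exact h _ (by simp)
    · refine ih _ fun l hl => h _ fun b hb => ?_
      rcases List.mem_cons.1 hb with rfl | hb
      · exact Or.inr ha
      · exact (hl b hb).imp_right Finset.mem_of_mem_erase

theorem peel_add (n : ℕ) (A : Finset ι) (φ ψ : List ι → ℝ) :
    peel p z n A (fun l => φ l + ψ l) = peel p z n A φ + peel p z n A ψ := by
  induction n generalizing A φ ψ with
  | zero => rfl
  | succ n ih =>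
    simp only [peel]
    rw [← Finset.sum_add_distrib]
    refine Finset.sum_congr rfl fun a _ => ?_
    rw [← mul_add]
    split_ifs
    · rfl
    · rw [ih]

theorem peel_nonneg (hp : ∀ A a, 0 ≤ p A a) (n : ℕ) (A : Finset ι) {φ : List ι → ℝ}
    (h : ∀ l, 0 ≤ φ l) : 0 ≤ peel p z n A φ := by
  induction n generalizing A φ with
  | zero => exact h _
  | succ n ih =>
    refine Finset.sum_nonneg fun a _ => mul_nonneg (hp A a) ?_
    split_ifs
    · exact h _
    · exact ih _ fun l => h _

theorem peel_sum {κ : Type*} (s : Finset κ) (n : ℕ) (A : Finset ι) (φ : κ → List ι → ℝ) :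
    peel p z n A (fun l => ∑ i ∈ s, φ i l) = ∑ i ∈ s, peel p z n A (φ i) := by
  classical
  induction s using Finset.induction with
  | empty =>
    simp only [Finset.sum_empty]
    -- Additivity at 0 + 0 = 0 forces the mean of the zero function to vanish.
    have := peel_add (p := p) (z := z) n A (fun _ => 0) (fun _ => 0)
    simp only [add_zero] at this
    linarith
  | insert i s hi ih =>
    simp only [Finset.sum_insert hi]
    rw [peel_add, ih]

/-- Peeling commutes with relabelling. -/
theorem peel_gibbs_map (σ : Equiv.Perm ι) (hz : σ z = z) (w : ι → ℝ) (n : ℕ) (A : Finset ι)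
    (φ : List ι → ℝ) :
    peel (gibbs w) z n (A.map σ.toEmbedding) φ =
      peel (gibbs (w ∘ σ)) z n A (fun l => φ (l.map σ)) := by
  induction n generalizing A φ with
  | zero => rfl
  | succ n ih =>
    simp only [peel, gibbs, Finset.sum_map, Equiv.coe_toEmbedding, Function.comp_apply]
    refine Finset.sum_congr rfl fun a _ => ?_
    have hiff : σ a = z ↔ a = z := by
      rw [← σ.injective.eq_iff (a := a), hz]
    simp only [hiff, List.map_cons, List.map_nil, hz]
    congr 1
    split_ifs with haz
    · rfl
    · have : (A.map σ.toEmbedding).erase (σ a) = (A.erase a).map σ.toEmbedding := by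
        rw [Finset.map_erase]
        rfl
      rw [this, ih]

/-- The probability that `a` is drawn before the stopping element `z`. -/
theorem peel_gibbs_mem_le {w : ι → ℝ} (hw : ∀ a, 0 < w a) {a : ι} (haz : a ≠ z) (n : ℕ)
    {A : Finset ι} (ha : a ∈ A) (hz : z ∈ A) :
    peel (gibbs w) z n A (fun l => if a ∈ l then 1 else 0) ≤ w a / (w a + w z) := by
  have hr : 0 ≤ w a / (w a + w z) := div_nonneg (hw a).le (add_pos (hw a) (hw z)).le
  have hr1 : w a / (w a + w z) ≤ 1 :=
    (div_le_one (add_pos (hw a) (hw z))).2 (by linarith [hw z])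
  induction n generalizing A with
  | zero => simpa [peel] using hr
  | succ n ih =>
    simp only [peel]
    have hrest : ∀ b ∈ (A.erase a).erase z, (gibbs w A b * if b = z then (if a ∈ [z] then 1 else 0)
        else peel (gibbs w) z n (A.erase b) (fun l => if a ∈ b :: l then 1 else 0)) ≤
        gibbs w A b * (w a / (w a + w z)) := by
      intro b hb
      simp only [Finset.mem_erase] at hb
      refine mul_le_mul_of_nonneg_left ?_ (gibbs_nonneg hw b)
      rw [if_neg hb.1]
      have : ∀ l : List ι, (a ∈ b :: l) = (a ∈ l) := by
        intro l
        simp [Ne.symm hb.2.1]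
      simp only [this]
      exact ih (Finset.mem_erase.2 ⟨Ne.symm hb.2.1, ha⟩) (Finset.mem_erase.2 ⟨Ne.symm hb.1, hz⟩)
    have hza : z ∈ A.erase a := Finset.mem_erase.2 ⟨haz.symm, hz⟩
    have hone : peel (gibbs w) z n (A.erase a) (fun l => if a ∈ a :: l then 1 else 0) ≤ 1 := by
      clear ih hrest
      have : ∀ (m : ℕ) (B : Finset ι), peel (gibbs w) z m B (fun _ => (1 : ℝ)) ≤ 1 := by
        intro m
        induction m with
        | zero => intro B; exact le_rfl
        | succ m ih =>
          intro B
          simp only [peel]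
          rcases B.eq_empty_or_nonempty with rfl | hB
          · simp
          · refine le_trans (Finset.sum_le_sum fun b _ => ?_) (sum_gibbs hw hB).le
            refine mul_le_of_le_one_right (gibbs_nonneg hw b) ?_
            split_ifs
            · exact le_rfl
            · exact ih _
      simpa using this n (A.erase a)
    rw [← Finset.add_sum_erase _ _ ha, ← Finset.add_sum_erase _ _ hza]
    have hsum := sum_gibbs hw ⟨a, ha⟩
    rw [← Finset.add_sum_erase _ _ ha, ← Finset.add_sum_erase _ _ hza] at hsum
    have hle := Finset.sum_le_sum hrest
    rw [← Finset.sum_mul] at hle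
    have hfa : gibbs w A a * (if a = z then (if a ∈ [z] then 1 else 0)
        else peel (gibbs w) z n (A.erase a) (fun l => if a ∈ a :: l then 1 else 0)) ≤
        gibbs w A a := by
      rw [if_neg haz]
      exact mul_le_of_le_one_right (gibbs_nonneg hw a) hone
    have hfz : gibbs w A z * (if z = z then (if a ∈ [z] then 1 else 0)
        else peel (gibbs w) z n (A.erase z) (fun l => if a ∈ z :: l then 1 else 0)) = 0 := by
      simp [haz]
    -- Within each step `a` and `z` are drawn in the fixed ratio w a : w z. With r = w a / (w a + w
    -- z), the bound p_a + r (1 - p_a - p_z) therefore equals r, and the induction closes with the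
    -- same constant.
    have hkey : gibbs w A a = (gibbs w A a + gibbs w A z) * (w a / (w a + w z)) := by
      have h1 := add_pos (hw a) (hw z)
      simp only [gibbs]
      rw [← add_div]
      field_simp
    have hrec : ∑ b ∈ (A.erase a).erase z, gibbs w A b = 1 - (gibbs w A a + gibbs w A z) := by
      linarith
    rw [hrec] at hle
    rw [hfz]
    nlinarith

/-- Pure composition of the peeling steps. -/
theorem peel_gibbs_le_pure {w u : ι → ℝ} (hw : ∀ a, 0 < w a) (hu : ∀ a, 0 < u a) {c e : ℝ}
    (he : 0 < e) (n : ℕ) {A : Finset ι} (h : RangeBounded A w u c e) {φ : List ι → ℝ}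
    (hφ : ∀ l, 0 ≤ φ l) :
    peel (gibbs w) z n A φ ≤ Real.exp (n * e) * peel (gibbs u) z n A φ := by
  induction n generalizing A φ with
  | zero => simp [peel]
  | succ n ih =>
    simp only [peel]
    rw [Finset.mul_sum]
    refine Finset.sum_le_sum fun a ha => ?_
    have hcont : (if a = z then φ [z] else
        peel (gibbs w) z n (A.erase a) (fun l => φ (a :: l))) ≤ Real.exp (n * e) *
        (if a = z then φ [z] else peel (gibbs u) z n (A.erase a) (fun l => φ (a :: l))) := by
      split_ifs with haz
      · exact le_mul_of_one_le_left (hφ _) (Real.one_le_exp (by positivity))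
      · exact ih (h.mono (Finset.erase_subset _ _)) fun l => hφ _
    have h0 : 0 ≤ (if a = z then φ [z] else
        peel (gibbs w) z n (A.erase a) (fun l => φ (a :: l))) := by
      split_ifs with haz
      · exact hφ _
      · exact peel_nonneg (fun A a => gibbs_nonneg hw a) _ _ fun l => hφ _
    refine (mul_le_mul (h.gibbs_le hw hu ha) hcont h0
      (mul_nonneg (Real.exp_pos _).le (gibbs_nonneg hu a))).trans (le_of_eq ?_)
    push_cast
    rw [add_mul, one_mul, Real.exp_add]
    ring

/-- Composition of the peeling steps with the moment generating function of the loss. -/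
theorem peel_gibbs_le {w u : ι → ℝ} (hw : ∀ a, 0 < w a) (hu : ∀ a, 0 < u a) {c e : ℝ}
    (he : 0 < e) {l : ℝ} (hl : 0 ≤ l) (n : ℕ) {A : Finset ι} (h : RangeBounded A w u c e)
    {φ : List ι → ℝ} (hφ : ∀ l, 0 ≤ φ l) (hφ1 : ∀ l, φ l ≤ 1) (t : ℝ) :
    peel (gibbs w) z n A φ ≤ Real.exp t * peel (gibbs u) z n A φ + Real.exp (-l * t) *
      Real.exp (l * (e * ((Real.exp e - 1) / (Real.exp e + 1))) + l ^ 2 * e ^ 2 / 8) ^ n := by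
  set M := Real.exp (l * (e * ((Real.exp e - 1) / (Real.exp e + 1))) + l ^ 2 * e ^ 2 / 8) with hM
  have hM1 : 1 ≤ M := by
    have : 1 ≤ Real.exp e := Real.one_le_exp he.le
    have : 0 ≤ (Real.exp e - 1) / (Real.exp e + 1) := div_nonneg (by linarith) (by linarith)
    exact Real.one_le_exp (by positivity)
  -- A process that has stopped must satisfy the tail bound for every `t`: the main term suffices if
  -- t ≥ 0, and the tail term is at least 1 if t ≤ 0.
  have hbase : ∀ (x : ℝ), 0 ≤ x → x ≤ 1 → ∀ K, 1 ≤ K → ∀ t : ℝ,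
      x ≤ Real.exp t * x + Real.exp (-l * t) * K := by
    intro x hx hx1 K hK t
    rcases le_total 0 t with ht | ht
    · have := le_mul_of_one_le_left hx (Real.one_le_exp ht)
      have : 0 ≤ Real.exp (-l * t) * K := by positivity
      linarith
    · have h1 : 1 ≤ Real.exp (-l * t) :=
        Real.one_le_exp (by nlinarith)
      have : 0 ≤ Real.exp t * x := by positivity
      nlinarith
  induction n generalizing A φ t with
  | zero => simpa [peel] using hbase _ (hφ []) (hφ1 []) 1 le_rfl t
  | succ n ih =>
    rcases A.eq_empty_or_nonempty with rfl | hA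
    · simp only [peel, Finset.sum_empty, mul_zero, zero_add]
      positivity
    · simp only [peel]
      rw [pow_succ]
      refine h.sum_gibbs_mul_le he hw hu hA hl (by positivity) (fun a ha t => ?_) t
      split_ifs with haz
      · exact hbase _ (hφ _) (hφ1 _) _ (one_le_pow₀ hM1) t
      · exact ih (h.mono (Finset.erase_subset _ _)) (fun l => hφ _) (fun l => hφ1 _) t

end Peel

/-! ### Gumbel noise as exponential clocks -/

section Gumbel

/-- If `G` has the Gumbel distribution of scale `1 / ε`, then `exp (-ε G)` is exponential. -/
theorem lintegral_gumbel {ε : ℝ} (hε : 0 < ε) {H : ℝ → ENNReal} (hH : Measurable H) :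
    ∫⁻ g, H (Real.exp (-(ε * g))) ∂gumbel (1 / ε) =
      ∫⁻ y in Set.Ioi 0, H y * ENNReal.ofReal (Real.exp (-y)) := by
  have himg : (fun g : ℝ => Real.exp (-(ε * g))) '' Set.univ = Set.Ioi 0 := by
    rw [Set.image_univ]
    ext y
    constructor
    · rintro ⟨g, rfl⟩
      exact Real.exp_pos _
    · intro hy
      refine ⟨-(Real.log y / ε), ?_⟩
      have : -(ε * -(Real.log y / ε)) = Real.log y := by field_simp
      simp only [this]
      exact Real.exp_log hy
  have hder : ∀ x ∈ (Set.univ : Set ℝ), HasDerivWithinAt (fun g : ℝ => Real.exp (-(ε * g)))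
      (-(ε * Real.exp (-(ε * x)))) Set.univ x := by
    intro x _
    have h : HasDerivAt (fun g : ℝ => Real.exp (-(ε * g)))
        (Real.exp (-(ε * x)) * -(ε * 1)) x := ((hasDerivAt_id x).const_mul ε).neg.exp
    refine (h.congr_deriv ?_).hasDerivWithinAt
    ring
  have hinj : Set.InjOn (fun g : ℝ => Real.exp (-(ε * g))) Set.univ := by
    intro x _ y _ hxy
    have := Real.exp_injective hxy
    exact mul_left_cancel₀ hε.ne' (neg_injective this)
  rw [← himg, lintegral_image_eq_lintegral_abs_deriv_mul MeasurableSet.univ hder hinj,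
    gumbel, lintegral_withDensity_eq_lintegral_mul _ (by fun_prop) (by fun_prop),
    setLIntegral_univ]
  refine lintegral_congr fun g => ?_
  have h1 : |-(ε * Real.exp (-(ε * g)))| = ε * Real.exp (-(ε * g)) := by
    rw [abs_neg, abs_of_pos (mul_pos hε (Real.exp_pos _))]
  have h2 : 1 / (1 / ε) * Real.exp (-(g / (1 / ε) + Real.exp (-g / (1 / ε)))) =
      ε * Real.exp (-(ε * g)) * Real.exp (-Real.exp (-(ε * g))) := by
    have h3 : -g / (1 / ε) = -(ε * g) := by field_simp
    have h4 : g / (1 / ε) = ε * g := by field_simp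
    rw [h3, h4, mul_assoc, ← Real.exp_add, one_div_one_div]
    ring_nf
  rw [Pi.mul_apply, h1, h2, ENNReal.ofReal_mul (mul_pos hε (Real.exp_pos _)).le]
  ring

theorem lintegral_exp_neg_mul_Ioi {r : ℝ} (hr : 0 < r) (c : ℝ) :
    ∫⁻ y in Set.Ioi c, ENNReal.ofReal (Real.exp (-(r * y))) =
      ENNReal.ofReal (Real.exp (-(r * c)) / r) := by
  have hr' : -r < 0 := neg_neg_of_pos hr
  have h := integral_exp_mul_Ioi hr' c
  simp only [neg_mul, neg_div_neg_eq] at h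
  have hi := integrableOn_exp_mul_Ioi hr' c
  simp only [neg_mul] at hi
  rw [← h, ofReal_integral_eq_lintegral_ofReal hi
    (Filter.Eventually.of_forall fun _ => (Real.exp_pos _).le)]

theorem isProbabilityMeasure_gumbel {ε : ℝ} (hε : 0 < ε) :
    IsProbabilityMeasure (gumbel (1 / ε)) := by
  constructor
  have h := lintegral_gumbel hε (H := fun _ => 1) measurable_const
  have h2 := lintegral_exp_neg_mul_Ioi one_pos 0
  simp only [one_mul, lintegral_const, mul_zero, neg_zero, Real.exp_zero, div_one,
    ENNReal.ofReal_one] at h h2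
  rw [h, h2]

instance nullSingletonClass_gumbel (b : ℝ) : NullSingletonClass (gumbel b) := by
  constructor
  intro x
  rw [gumbel, withDensity_apply _ (measurableSet_singleton x)]
  simp

/-- One competitor in a race of exponential clocks, of rate `exp (ε s)`, against the others, of
total rate `r`, after time `c`. -/
theorem lintegral_gumbel_race {ε : ℝ} (hε : 0 < ε) (s : ℝ) {c r : ℝ} (hc : 0 ≤ c) (hr : 0 ≤ r) :
    ∫⁻ g, ENNReal.ofReal ((if c < Real.exp (-(ε * (s + g))) then 1 else 0) *
        Real.exp (-(Real.exp (-(ε * (s + g))) * r))) ∂gumbel (1 / ε) =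
      ENNReal.ofReal (Real.exp (ε * s) / (Real.exp (ε * s) + r) *
        Real.exp (-(c * (Real.exp (ε * s) + r)))) := by
  set a := Real.exp (ε * s) with ha
  have hapos : 0 < a := Real.exp_pos _
  have hexp : ∀ g, Real.exp (-(ε * (s + g))) = Real.exp (-(ε * g)) / a := by
    intro g
    rw [ha, ← Real.exp_sub]
    ring_nf
  simp only [hexp]
  have hmeas : Measurable fun y : ℝ => ENNReal.ofReal ((if c < y / a then 1 else 0) *
      Real.exp (-(y / a * r))) := by
    refine ENNReal.measurable_ofReal.comp (Measurable.mul ?_ (by fun_prop))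
    exact Measurable.ite (measurableSet_lt measurable_const (by fun_prop)) measurable_const
      measurable_const
  rw [lintegral_gumbel hε hmeas]
  have hq : 0 < 1 + r / a := by positivity
  have hind : ∀ y ∈ Set.Ioi (0 : ℝ), ENNReal.ofReal ((if c < y / a then 1 else 0) *
      Real.exp (-(y / a * r))) * ENNReal.ofReal (Real.exp (-y)) =
      (Set.Ioi (c * a)).indicator
        (fun y => ENNReal.ofReal (Real.exp (-((1 + r / a) * y)))) y := by
    intro y _
    by_cases hy : c < y / a
    · rw [Set.indicator_of_mem (by exact (lt_div_iff₀ hapos).1 hy), if_pos hy, one_mul,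
        ← ENNReal.ofReal_mul (Real.exp_pos _).le, ← Real.exp_add]
      congr 2
      field_simp
      ring
    · rw [Set.indicator_of_notMem (s := Set.Ioi (c * a))
        (fun h => hy ((lt_div_iff₀ hapos).2 h)), if_neg hy]
      simp
  rw [setLIntegral_congr_fun measurableSet_Ioi hind, setLIntegral_indicator measurableSet_Ioi,
    Set.inter_eq_left.2 (Set.Ioi_subset_Ioi (by positivity)), lintegral_exp_neg_mul_Ioi hq]
  congr 1
  have h1 : (1 + r / a) * (c * a) = c * (a + r) := by field_simp
  rw [h1]
  field_simp

end Gumbel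

/-! ### Races of exponential clocks and the law of noisy sorting -/

section Race

variable {ι : Type*} [DecidableEq ι]

/-- The indicator of the event that `a` has the largest value in `A`. -/
noncomputable def topIndicator (v : ι → ℝ) (A : Finset ι) (a : ι) : ℝ :=
  if ∀ b ∈ A.erase a, v b < v a then 1 else 0

theorem topIndicator_nonneg (v : ι → ℝ) (A : Finset ι) (a : ι) : 0 ≤ topIndicator v A a := by
  unfold topIndicator
  split_ifs <;> norm_num

theorem measurable_topIndicator [Fintype ι] (s : ι → ℝ) (A : Finset ι) (a : ι) :
    Measurable fun g : ι → ℝ => topIndicator (fun b => s b + g b) A a := by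
  unfold topIndicator
  refine Measurable.ite ?_ measurable_const measurable_const
  simp only [Set.ofPred_forall]
  exact Finset.measurableSet_biInter _ fun b _ => measurableSet_lt (by fun_prop) (by fun_prop)

theorem measurable_peel_topIndicator [Fintype ι] (s : ι → ℝ) (z : ι) (n : ℕ) (A : Finset ι)
    (φ : List ι → ℝ) :
    Measurable fun g : ι → ℝ => peel (topIndicator fun b => s b + g b) z n A φ := by
  induction n generalizing A φ with
  | zero => exact measurable_const
  | succ n ih =>
    simp only [peel]
    refine Finset.measurable_sum _ fun a _ => (measurable_topIndicator s A a).mul ?_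
    split_ifs
    · exact measurable_const
    · exact ih _ _

variable [Fintype ι]

theorem measurable_survival (ε c : ℝ) (s : ι → ℝ) (A : Finset ι) :
    Measurable fun g : ι → ℝ =>
      if ∀ b ∈ A, c < Real.exp (-(ε * (s b + g b))) then (1 : ℝ) else 0 := by
  refine Measurable.ite ?_ measurable_const measurable_const
  simp only [Set.ofPred_forall]
  exact Finset.measurableSet_biInter _ fun b _ => measurableSet_lt (by fun_prop) (by fun_prop)

/-- The first step of a race on `A`: the winner is `a`, and the remaining race starts at the time
where `a` rings. -/
theorem lmarginal_race_step {ε : ℝ} (hε : 0 < ε) (s : ι → ℝ) {A : Finset ι} {a : ι} (ha : a ∈ A)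
    {X : (ι → ℝ) → ℝ} (hX : Measurable X) {P : ℝ}
    (ih : ∀ c : ℝ, 0 ≤ c → ∀ x, lmarginal (fun _ => gumbel (1 / ε)) (A.erase a) (fun g =>
      ENNReal.ofReal ((if ∀ b ∈ A.erase a, c < Real.exp (-(ε * (s b + g b))) then 1 else 0) *
        X g)) x =
      ENNReal.ofReal (Real.exp (-(c * ∑ b ∈ A.erase a, Real.exp (ε * s b))) * P))
    {c : ℝ} (hc : 0 ≤ c) (x : ι → ℝ) :
    lmarginal (fun _ => gumbel (1 / ε)) A (fun g =>
      ENNReal.ofReal ((if ∀ b ∈ A, c < Real.exp (-(ε * (s b + g b))) then 1 else 0) *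
        (topIndicator (fun b => s b + g b) A a * X g))) x =
      ENNReal.ofReal (Real.exp (-(c * ∑ b ∈ A, Real.exp (ε * s b))) *
        (gibbs (fun b => Real.exp (ε * s b)) A a * P)) := by
  have := isProbabilityMeasure_gumbel hε
  -- If `a` rings first, then all clocks survive time `c` iff the clock of `a` does; and `a` rings
  -- first iff all others survive its ringing time. So the hypothesis `ih` is applied with this
  -- random time in place of `c`.
  have hcond : ∀ g : ι → ℝ,
      (if ∀ b ∈ A, c < Real.exp (-(ε * (s b + g b))) then (1 : ℝ) else 0) *
        (topIndicator (fun b => s b + g b) A a * X g) =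
      (if c < Real.exp (-(ε * (s a + g a))) then 1 else 0) *
        ((if ∀ b ∈ A.erase a, Real.exp (-(ε * (s a + g a))) < Real.exp (-(ε * (s b + g b)))
          then 1 else 0) * X g) := by
    intro g
    have hiff : ∀ b, Real.exp (-(ε * (s a + g a))) < Real.exp (-(ε * (s b + g b))) ↔
        s b + g b < s a + g a := by
      intro b
      rw [Real.exp_lt_exp, neg_lt_neg_iff, mul_lt_mul_iff_right₀ hε]
    simp only [topIndicator, hiff]
    rw [← mul_assoc, ← mul_assoc]
    refine congrArg (· * X g) ?_
    by_cases h1 : ∀ b ∈ A.erase a, s b + g b < s a + g a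
    · rw [if_pos h1, mul_one]
      rw [if_pos h1, mul_one]
      by_cases h2 : c < Real.exp (-(ε * (s a + g a)))
      · rw [if_pos h2, if_pos]
        intro b hb
        rcases eq_or_ne b a with rfl | hba
        · exact h2
        · exact h2.trans ((hiff b).2 (h1 b (Finset.mem_erase.2 ⟨hba, hb⟩)))
      · rw [if_neg h2, if_neg fun h => h2 (h a ha)]
    · simp only [if_neg h1, mul_zero]
  have hmeas : Measurable fun g : ι → ℝ => ENNReal.ofReal
      ((if ∀ b ∈ A, c < Real.exp (-(ε * (s b + g b))) then (1 : ℝ) else 0) *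
        (topIndicator (fun b => s b + g b) A a * X g)) :=
    ENNReal.measurable_ofReal.comp ((measurable_survival ε c s A).mul
      ((measurable_topIndicator s A a).mul hX))
  have hpeel : ∀ y : ℝ, lmarginal (fun _ => gumbel (1 / ε)) (A.erase a) (fun g => ENNReal.ofReal
      ((if ∀ b ∈ A, c < Real.exp (-(ε * (s b + g b))) then (1 : ℝ) else 0) *
        (topIndicator (fun b => s b + g b) A a * X g))) (Function.update x a y) =
      ENNReal.ofReal ((if c < Real.exp (-(ε * (s a + y))) then 1 else 0) *
        Real.exp (-(Real.exp (-(ε * (s a + y))) * ∑ b ∈ A.erase a, Real.exp (ε * s b)))) *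
        ENNReal.ofReal P := by
    intro y
    have h1 := ih (Real.exp (-(ε * (s a + y)))) (Real.exp_pos _).le (Function.update x a y)
    rw [lmarginal] at h1 ⊢
    have hu : ∀ ω, Function.updateFinset (Function.update x a y) (A.erase a) ω a = y := by
      intro ω
      simp [Function.updateFinset_def]
    simp only [hcond, hu]
    have h01 : (0 : ℝ) ≤ if c < Real.exp (-(ε * (s a + y))) then 1 else 0 := by
      split_ifs <;> norm_num
    simp only [ENNReal.ofReal_mul h01]
    rw [lintegral_const_mul' _ _ ENNReal.ofReal_ne_top, h1,
      ENNReal.ofReal_mul (Real.exp_pos _).le, mul_assoc]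
  rw [lmarginal_erase _ hmeas ha]
  simp only [hpeel]
  rw [lintegral_mul_const' _ _ ENNReal.ofReal_ne_top,
    lintegral_gumbel_race hε (s a) hc (Finset.sum_nonneg fun b _ => (Real.exp_pos _).le),
    ← ENNReal.ofReal_mul (by positivity), gibbs,
    Finset.add_sum_erase _ (fun b => Real.exp (ε * s b)) ha]
  congr 1
  ring

/-- The rates of independent exponential clocks add up under the minimum. This is the end of the
recursion, where the rest of the process is a constant `P`. -/
theorem lmarginal_survival {ε : ℝ} (hε : 0 < ε) (s : ι → ℝ) (A : Finset ι) {c : ℝ} (hc : 0 ≤ c)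
    (P : ℝ) (x : ι → ℝ) :
    lmarginal (fun _ => gumbel (1 / ε)) A (fun g =>
      ENNReal.ofReal ((if ∀ b ∈ A, c < Real.exp (-(ε * (s b + g b))) then 1 else 0) * P)) x =
      ENNReal.ofReal (Real.exp (-(c * ∑ b ∈ A, Real.exp (ε * s b))) * P) := by
  have := isProbabilityMeasure_gumbel hε
  induction A using Finset.induction generalizing x with
  | empty => simp
  | insert a A ha ih =>
    have hmeas : Measurable fun g : ι → ℝ => ENNReal.ofReal
        ((if ∀ b ∈ insert a A, c < Real.exp (-(ε * (s b + g b))) then 1 else 0) * P) :=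
      ENNReal.measurable_ofReal.comp ((measurable_survival ε c s _).mul measurable_const)
    rw [lmarginal_insert _ hmeas ha]
    -- The factor with `* 0` is 1; it brings the integrand into the form of a race against
    -- competitors of total rate 0.
    have hpeel : ∀ y : ℝ, lmarginal (fun _ => gumbel (1 / ε)) A (fun g => ENNReal.ofReal
        ((if ∀ b ∈ insert a A, c < Real.exp (-(ε * (s b + g b))) then 1 else 0) * P))
        (Function.update x a y) =
        ENNReal.ofReal ((if c < Real.exp (-(ε * (s a + y))) then 1 else 0) *
          Real.exp (-(Real.exp (-(ε * (s a + y))) * 0))) *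
        ENNReal.ofReal (Real.exp (-(c * ∑ b ∈ A, Real.exp (ε * s b))) * P) := by
      intro y
      rw [← ih (Function.update x a y), lmarginal, lmarginal,
        ← lintegral_const_mul' _ _ ENNReal.ofReal_ne_top]
      refine lintegral_congr fun ω => ?_
      have hu : Function.updateFinset (Function.update x a y) A ω a = y := by
        simp [Function.updateFinset_def, ha]
      rw [← ENNReal.ofReal_mul (mul_nonneg (by split_ifs <;> norm_num) (Real.exp_pos _).le)]
      simp only [Finset.forall_mem_insert, hu, mul_zero, neg_zero, Real.exp_zero, mul_one]
      rw [← mul_assoc]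
      congr 2
      by_cases h1 : c < Real.exp (-(ε * (s a + y))) <;> simp [h1]
    simp only [hpeel]
    rw [lintegral_mul_const' _ _ ENNReal.ofReal_ne_top, lintegral_gumbel_race hε (s a) hc le_rfl,
      ← ENNReal.ofReal_mul (by positivity), add_zero, div_self (Real.exp_pos _).ne', one_mul,
      ← mul_assoc, ← Real.exp_add, Finset.sum_insert ha]
    congr 3
    ring

/-- Sorting by values with Gumbel noise is drawing without replacement from the exponential
mechanism. -/
theorem lmarginal_peel {ε : ℝ} (hε : 0 < ε) (s : ι → ℝ) (z : ι) (n : ℕ) (A : Finset ι)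
    {φ : List ι → ℝ} (hφ : ∀ l, 0 ≤ φ l) {c : ℝ} (hc : 0 ≤ c) (x : ι → ℝ) :
    lmarginal (fun _ => gumbel (1 / ε)) A (fun g =>
      ENNReal.ofReal ((if ∀ b ∈ A, c < Real.exp (-(ε * (s b + g b))) then 1 else 0) *
        peel (topIndicator fun b => s b + g b) z n A φ)) x =
      ENNReal.ofReal (Real.exp (-(c * ∑ b ∈ A, Real.exp (ε * s b))) *
        peel (gibbs fun b => Real.exp (ε * s b)) z n A φ) := by
  have hw : ∀ b, 0 < Real.exp (ε * s b) := fun b => Real.exp_pos _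
  induction n generalizing A φ c x with
  | zero => exact lmarginal_survival hε s A hc _ x
  | succ n ih =>
    have hstep : ∀ a ∈ A, lmarginal (fun _ => gumbel (1 / ε)) A (fun g =>
        ENNReal.ofReal ((if ∀ b ∈ A, c < Real.exp (-(ε * (s b + g b))) then 1 else 0) *
          (topIndicator (fun b => s b + g b) A a * if a = z then φ [z] else
            peel (topIndicator fun b => s b + g b) z n (A.erase a) (fun l => φ (a :: l))))) x =
        ENNReal.ofReal (Real.exp (-(c * ∑ b ∈ A, Real.exp (ε * s b))) *
          (gibbs (fun b => Real.exp (ε * s b)) A a * if a = z then φ [z] else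
            peel (gibbs fun b => Real.exp (ε * s b)) z n (A.erase a) (fun l => φ (a :: l)))) := by
      intro a ha
      split_ifs with haz
      · exact lmarginal_race_step hε s ha measurable_const
          (fun c hc x => lmarginal_survival hε s _ hc _ x) hc x
      · exact lmarginal_race_step hε s ha (measurable_peel_topIndicator s z n _ _)
          (fun c hc x => ih (A.erase a) (fun l => hφ _) hc x) hc x
    have h01 : ∀ g : ι → ℝ,
        (0 : ℝ) ≤ if ∀ b ∈ A, c < Real.exp (-(ε * (s b + g b))) then 1 else 0 := by
      intro g
      split_ifs <;> norm_num
    simp only [peel]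
    simp only [Finset.mul_sum A (fun a => gibbs _ _ _ * _),
      Finset.mul_sum A (fun a => topIndicator _ _ _ * _)]
    rw [ENNReal.ofReal_sum_of_nonneg, ← Finset.sum_congr rfl hstep]
    · simp only [lmarginal]
      rw [← lintegral_finsetSum']
      · refine lintegral_congr fun y => ?_
        rw [ENNReal.ofReal_sum_of_nonneg]
        intro a _
        refine mul_nonneg (h01 _) (mul_nonneg (topIndicator_nonneg _ _ _) ?_)
        split_ifs
        · exact hφ _
        · exact peel_nonneg (topIndicator_nonneg _) _ _ fun l => hφ _
      · intro a _
        have hX : Measurable fun g : ι → ℝ => if a = z then φ [z] else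
            peel (topIndicator fun b => s b + g b) z n (A.erase a) (fun l => φ (a :: l)) := ?_
        · exact ((ENNReal.measurable_ofReal.comp ((measurable_survival ε c s A).mul
            ((measurable_topIndicator s A a).mul hX))).comp measurable_updateFinset).aemeasurable
        split_ifs
        · exact measurable_const
        · exact measurable_peel_topIndicator s z n _ _
    · intro a _
      refine mul_nonneg (Real.exp_pos _).le (mul_nonneg (gibbs_nonneg hw a) ?_)
      split_ifs
      · exact hφ _
      · exact peel_nonneg (fun A a => gibbs_nonneg hw a) _ _ fun l => hφ _

/-- This is the race started at time 0, which every clock survives; coordinates outside `A`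
integrate to 1. -/
theorem lintegral_peel {ε : ℝ} (hε : 0 < ε) (s : ι → ℝ) (z : ι) (n : ℕ) (A : Finset ι)
    {φ : List ι → ℝ} (hφ : ∀ l, 0 ≤ φ l) :
    ∫⁻ g, ENNReal.ofReal (peel (topIndicator fun b => s b + g b) z n A φ)
      ∂Measure.pi (fun _ : ι => gumbel (1 / ε)) =
      ENNReal.ofReal (peel (gibbs fun b => Real.exp (ε * s b)) z n A φ) := by
  have := isProbabilityMeasure_gumbel hε
  have hmeas : Measurable fun g : ι → ℝ =>
      ENNReal.ofReal (peel (topIndicator fun b => s b + g b) z n A φ) :=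
    ENNReal.measurable_ofReal.comp (measurable_peel_topIndicator s z n A φ)
  rw [lintegral_eq_of_lmarginal_eq A hmeas
    (g := fun _ => ENNReal.ofReal (peel (gibbs fun b => Real.exp (ε * s b)) z n A φ))
    measurable_const]
  · rw [lintegral_const, measure_univ, mul_one]
  · funext x
    have h := lmarginal_peel hε s z n A hφ le_rfl x
    simp only [Real.exp_pos, implies_true, if_true, one_mul, zero_mul, neg_zero,
      Real.exp_zero] at h
    rw [h, lmarginal, lintegral_const, measure_univ, mul_one]

/-- Values with Gumbel noise are almost surely distinct. -/
theorem ae_injective {ε : ℝ} (hε : 0 < ε) (s : ι → ℝ) :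
    ∀ᵐ g ∂Measure.pi (fun _ : ι => gumbel (1 / ε)), Function.Injective fun b => s b + g b := by
  have := isProbabilityMeasure_gumbel hε
  have hpair : ∀ a b : ι, a ≠ b →
      ∀ᵐ g ∂Measure.pi (fun _ : ι => gumbel (1 / ε)), s a + g a ≠ s b + g b := by
    intro a b hab
    have hms : MeasurableSet {g : ι → ℝ | s a + g a = s b + g b} :=
      measurableSet_eq_fun (by fun_prop) (by fun_prop)
    have hzero : ∫⁻ g, {g : ι → ℝ | s a + g a = s b + g b}.indicator 1 g
        ∂Measure.pi (fun _ : ι => gumbel (1 / ε)) = 0 := by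
      -- Once all coordinates but `a` are fixed, a tie forces the coordinate `a` to be a single
      -- value, which is a null set for the Gumbel law.
      rw [lintegral_eq_of_lmarginal_eq {a} (g := fun _ => 0)
        (measurable_one.indicator hms) measurable_const]
      · simp
      · rw [lmarginal_singleton, lmarginal_singleton]
        funext x
        rw [lintegral_zero, ← nonpos_iff_eq_zero]
        calc ∫⁻ y, {g : ι → ℝ | s a + g a = s b + g b}.indicator 1 (Function.update x a y)
              ∂gumbel (1 / ε)
            ≤ ∫⁻ y, ({s b + x b - s a} : Set ℝ).indicator 1 y ∂gumbel (1 / ε) := by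
              refine lintegral_mono fun y => ?_
              by_cases hy : y = s b + x b - s a
              · simp only [hy, Set.indicator_of_mem (Set.mem_singleton _), Pi.one_apply]
                exact Set.indicator_le_self' (fun _ _ => zero_le) _
              · rw [Set.indicator_of_notMem]
                · exact zero_le
                · simp only [Set.mem_ofPred_eq, Function.update_self,
                    Function.update_of_ne hab.symm]
                  intro h
                  exact hy (by linarith)
          _ = 0 := by
              rw [lintegral_indicator_one (measurableSet_singleton _), measure_singleton]
          _ ≤ 0 := le_rfl
    rw [lintegral_indicator_one hms] at hzero
    rw [ae_iff]
    simpa using hzero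
  have hall : ∀ᵐ g ∂Measure.pi (fun _ : ι => gumbel (1 / ε)),
      ∀ a b : ι, a ≠ b → s a + g a ≠ s b + g b := by
    rw [ae_all_iff]
    intro a
    rw [ae_all_iff]
    intro b
    by_cases hab : a = b
    · exact Filter.Eventually.of_forall fun _ h => absurd hab h
    · filter_upwards [hpair a b hab] with g hg _ using hg
  filter_upwards [hall] with g hg a b hab
  by_contra hne
  exact hg a b hne hab

end Race

/-! ### Truncated lists and entries of decreasing lists -/

section Lists

/-- The first `n` entries of a list, up to and including the first `z`. -/
def truncateAt {ι : Type*} [DecidableEq ι] (z : ι) : ℕ → List ι → List ι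
  | 0, _ => []
  | _ + 1, [] => []
  | n + 1, a :: l => if a = z then [z] else a :: truncateAt z n l

/-- Drawing the elements of `A` by decreasing values. -/
theorem peel_topIndicator {ι : Type*} [DecidableEq ι] {v : ι → ℝ} {z : ι} (n : ℕ) {L : List ι}
    (hL : L.Pairwise fun a b => v b < v a) (hz : z ∈ L) (φ : List ι → ℝ) :
    peel (topIndicator v) z n L.toFinset φ = φ (truncateAt z n L) := by
  induction n generalizing L φ with
  | zero => rfl
  | succ n ih =>
    cases L with
    | nil => simp at hz
    | cons a L =>
      rw [List.pairwise_cons] at hL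
      have haL : a ∉ L := fun h => lt_irrefl _ (hL.1 a h)
      have herase : ((a :: L).toFinset).erase a = L.toFinset := by
        rw [List.toFinset_cons, Finset.erase_insert (by simpa using haL)]
      simp only [peel]
      rw [Finset.sum_eq_single a]
      · have htop : topIndicator v (a :: L).toFinset a = 1 := by
          rw [topIndicator, if_pos]
          intro b hb
          rw [herase, List.mem_toFinset] at hb
          exact hL.1 b hb
        rw [htop, one_mul, truncateAt, herase]
        split_ifs with haz
        · rfl
        · exact ih hL.2 (List.mem_of_ne_of_mem (Ne.symm haz) hz) _
      · intro b hb hba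
        have hbL : b ∈ L := List.mem_of_ne_of_mem hba (List.mem_toFinset.1 hb)
        rw [topIndicator, if_neg, zero_mul]
        intro h
        exact lt_asymm (hL.1 b hbL) (h a (Finset.mem_erase.2 ⟨hba.symm, by simp⟩))
      · intro h
        simp at h

/-- Both branches of the output rule of the limited domain algorithm obey the one recursion that
peeling follows. -/
theorem truncateAt_none {α : Type*} [DecidableEq α] (n : ℕ) {L : List (Option α)}
    (hL : none ∈ L) :
    (if (L.takeWhile Option.isSome).length < n then L.takeWhile Option.isSome ++ [none]
      else (L.takeWhile Option.isSome).take n) = truncateAt none n L := by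
  induction L generalizing n with
  | nil => simp at hL
  | cons a L ih =>
    cases n with
    | zero => simp [truncateAt]
    | succ n =>
      cases a with
      | none => simp [truncateAt]
      | some i =>
        have h := ih n (by simpa using hL)
        simp only [truncateAt, reduceCtorEq, if_false, ← h, Option.isSome_some,
          List.takeWhile_cons, if_true, List.length_cons, Nat.add_lt_add_iff_right,
          List.take_succ_cons, List.cons_append]
        split_ifs <;> rfl

/-- The `m`-th entry of a decreasing list is at least `c` iff more than `m` entries are. -/
theorem le_getD_iff_lt_countP {L : List ℕ} (hL : L.Pairwise (· ≥ ·)) {c : ℕ} (hc : 0 < c)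
    (m : ℕ) : c ≤ L.getD m 0 ↔ m < L.countP (fun a => c ≤ a) := by
  induction L generalizing m with
  | nil => simp; omega
  | cons a L ih =>
    rw [List.pairwise_cons] at hL
    rw [List.countP_cons]
    by_cases hca : c ≤ a
    · cases m with
      | zero => simp [hca]
      | succ m =>
        rw [List.getD_cons_succ, ih hL.2]
        simp [hca]
    · have h0 : L.countP (fun a => c ≤ a) = 0 := by
        rw [List.countP_eq_zero]
        intro b hb
        have := hL.1 b hb
        simp only [decide_eq_true_eq]
        omega
      cases m with
      | zero => simp [hca, h0]
      | succ m =>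
        rw [List.getD_cons_succ, ih hL.2]
        simp [hca, h0]

end Lists

/-! ### Ordered counts and top sets of neighboring histograms -/

section Ranking

variable {d : ℕ} (τ : Equiv.Perm (Fin d)) (h : Fin d → ℕ)

theorem ranking_perm : (ranking τ h).Perm (List.finRange d) :=
  List.perm_insertionSort _ _

theorem nodup_ranking : (ranking τ h).Nodup :=
  (ranking_perm τ h).nodup_iff.2 (List.nodup_finRange d)

theorem mem_ranking (i : Fin d) : i ∈ ranking τ h :=
  (ranking_perm τ h).mem_iff.2 (List.mem_finRange i)

theorem length_ranking : (ranking τ h).length = d := by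
  rw [(ranking_perm τ h).length_eq, List.length_finRange]

theorem pairwise_ranking : (ranking τ h).Pairwise fun a b => h b ≤ h a := by
  have hr : (ranking τ h).Pairwise fun a b => h b < h a ∨ (h a = h b ∧ τ a ≤ τ b) := by
    have : Std.Total fun a b : Fin d => h b < h a ∨ (h a = h b ∧ τ a ≤ τ b) :=
      ⟨fun a b => by
        rcases lt_trichotomy (h a) (h b) with hab | hab | hab
        · exact Or.inr (Or.inl hab)
        · rcases le_total (τ a) (τ b) with ht | ht
          · exact Or.inl (Or.inr ⟨hab, ht⟩)
          · exact Or.inr (Or.inr ⟨hab.symm, ht⟩)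
        · exact Or.inl (Or.inl hab)⟩
    have : IsTrans (Fin d) fun a b : Fin d => h b < h a ∨ (h a = h b ∧ τ a ≤ τ b) :=
      ⟨fun a b c hab hbc => by
        rcases hab with hab | ⟨hab, ht⟩ <;> rcases hbc with hbc | ⟨hbc, ht'⟩
        · exact Or.inl (hbc.trans hab)
        · exact Or.inl (hbc ▸ hab)
        · exact Or.inl (hab ▸ hbc)
        · exact Or.inr ⟨hab.trans hbc, ht.trans ht'⟩⟩
    exact List.pairwise_insertionSort _ _
  exact hr.imp fun {a b} hab => hab.elim le_of_lt fun hab => hab.1.ge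

/-- The set of the `m` top-ranked elements. -/
def topSet (m : ℕ) : Finset (Fin d) :=
  ((ranking τ h).take m).toFinset

theorem card_topSet {m : ℕ} (hm : m ≤ d) : (topSet τ h m).card = m := by
  rw [topSet, List.toFinset_card_of_nodup ((nodup_ranking τ h).sublist (List.take_sublist _ _)),
    List.length_take, length_ranking, min_eq_left hm]

theorem le_of_mem_topSet {m : ℕ} {a b : Fin d} (ha : a ∈ topSet τ h m) (hb : b ∉ topSet τ h m) :
    h b ≤ h a := by
  simp only [topSet, List.mem_toFinset] at ha hb
  have hp := pairwise_ranking τ h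
  rw [← List.take_append_drop m (ranking τ h), List.pairwise_append] at hp
  refine hp.2.2 a ha b ?_
  have := mem_ranking τ h b
  rw [← List.take_append_drop m (ranking τ h), List.mem_append] at this
  exact this.resolve_left hb

/-- An order statistic is determined by the sizes of the upper level sets, so the tie-breaking order
drops out. Its monotonicity and its change by at most 1 both follow by comparing level sets.
Positivity of `c` is needed because the default value 0 past the end satisfies 0 ≤ 0. -/
theorem le_orderedCount_iff {j c : ℕ} (hj : 0 < j) (hc : 0 < c) :
    c ≤ orderedCount τ h j ↔ j ≤ (Finset.univ.filter fun i => c ≤ h i).card := by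
  have hp : ((ranking τ h).map h).Pairwise (· ≥ ·) :=
    List.pairwise_map.2 (pairwise_ranking τ h)
  have hcount : ((ranking τ h).map h).countP (fun a => c ≤ a) =
      (Finset.univ.filter fun i => c ≤ h i).card := by
    rw [List.countP_map, List.countP_eq_length_filter,
      ← List.toFinset_card_of_nodup ((nodup_ranking τ h).filter _)]
    congr 1
    ext i
    simp [mem_ranking]
  rw [orderedCount, le_getD_iff_lt_countP hp hc, hcount]
  omega

/-- The element `b` and the `m` top elements are m + 1 elements with counts at least h b. -/
theorem le_orderedCount_of_notMem {m : ℕ} (hm : m ≤ d) {b : Fin d} (hb : b ∉ topSet τ h m) :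
    h b ≤ orderedCount τ h (m + 1) := by
  rcases Nat.eq_zero_or_pos (h b) with h0 | h0
  · omega
  · rw [le_orderedCount_iff τ h (Nat.succ_pos m) h0]
    have hsub : insert b (topSet τ h m) ⊆ Finset.univ.filter fun i => h b ≤ h i := by
      intro a ha
      rw [Finset.mem_filter]
      refine ⟨Finset.mem_univ a, ?_⟩
      rcases Finset.mem_insert.1 ha with rfl | ha
      · exact le_rfl
      · exact le_of_mem_topSet τ h ha hb
    have := Finset.card_le_card hsub
    rwa [Finset.card_insert_of_notMem hb, card_topSet τ h hm] at this

variable {τ h}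

theorem orderedCount_mono {h' : Fin d → ℕ} (hle : ∀ i, h i ≤ h' i) {j : ℕ} (hj : 0 < j) :
    orderedCount τ h j ≤ orderedCount τ h' j := by
  rcases Nat.eq_zero_or_pos (orderedCount τ h j) with h0 | h0
  · omega
  · rw [le_orderedCount_iff τ h' hj h0]
    refine ((le_orderedCount_iff τ h hj h0).1 le_rfl).trans (Finset.card_le_card fun i hi => ?_)
    rw [Finset.mem_filter] at hi ⊢
    exact ⟨hi.1, hi.2.trans (hle i)⟩

theorem orderedCount_le_add_one {h' : Fin d → ℕ} (hle : ∀ i, h' i ≤ h i + 1) {j : ℕ}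
    (hj : 0 < j) : orderedCount τ h' j ≤ orderedCount τ h j + 1 := by
  rcases Nat.lt_or_ge 1 (orderedCount τ h' j) with h1 | h1
  · have : orderedCount τ h' j - 1 ≤ orderedCount τ h j := by
      rw [le_orderedCount_iff τ h hj (by omega)]
      refine ((le_orderedCount_iff τ h' hj (by omega)).1 le_rfl).trans
        (Finset.card_le_card fun i hi => ?_)
      rw [Finset.mem_filter] at hi ⊢
      have := hle i
      exact ⟨hi.1, by omega⟩
    omega
  · omega

/-- Finite sets of equal size are related by a permutation that fixes their common elements. -/
theorem exists_perm_map_eq {α : Type*} [Fintype α] [DecidableEq α] {D D' : Finset α}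
    (hcard : D.card = D'.card) :
    ∃ σ : Equiv.Perm α, D.map σ.toEmbedding = D' ∧ ∀ a ∈ D, a ∈ D' → σ a = a := by
  -- The identity on the common elements extends to a bijection of the two sets, which then extends
  -- to the whole type.
  obtain ⟨g, hg⟩ := Set.MapsTo.exists_equiv_extend_of_card_eq (α := D) (t := D')
    (by simpa using hcard) (s := {a | (a : α) ∈ D'}) (f := fun a => a) (fun a ha => ha)
    (Subtype.val_injective.injOn)
  refine ⟨g.extendSubtype, ?_, fun a ha ha' => ?_⟩
  · refine Finset.eq_of_subset_of_card_le (fun b hb => ?_) (by rw [Finset.card_map, hcard])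
    obtain ⟨a, ha, rfl⟩ := Finset.mem_map.1 hb
    exact g.extendSubtype_mem a ha
  · exact (g.extendSubtype_apply_of_mem a ha).trans (hg ⟨a, ha⟩ ha')

/-- The counts of matched elements of the top sets of neighboring histograms differ by `0` or `1`
in the direction of the change. -/
theorem count_le_count_map {h' : Fin d → ℕ} (hle : ∀ i, h i ≤ h' i) (hle' : ∀ i, h' i ≤ h i + 1)
    {m : ℕ} {σ : Equiv.Perm (Fin d)} (hσ : (topSet τ h m).map σ.toEmbedding = topSet τ h' m)
    (hfix : ∀ a ∈ topSet τ h m, a ∈ topSet τ h' m → σ a = a) {i : Fin d}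
    (hi : i ∈ topSet τ h m) : h i ≤ h' (σ i) ∧ h' (σ i) ≤ h i + 1 := by
  by_cases hi' : i ∈ topSet τ h' m
  · rw [hfix i hi hi']
    exact ⟨hle i, hle' i⟩
  · have hσi : σ i ∈ topSet τ h' m := hσ ▸ Finset.mem_map_of_mem σ.toEmbedding hi
    have hσi' : σ i ∉ topSet τ h m := fun hmem =>
      hi' ((σ.injective (hfix _ hmem hσi)) ▸ hσi)
    -- Here `i` left the top set and `σ i` entered it, so h i ≤ h' i ≤ h' (σ i) ≤ h (σ i) + 1 ≤ h i
    -- + 1.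
    have h1 := le_of_mem_topSet τ h' hσi hi'
    have h2 := le_of_mem_topSet τ h hi hσi'
    have h3 := hle i
    have h4 := hle' (σ i)
    omega

end Ranking

/-! ### The algorithm for a fixed noise sample -/

section Mechanism

variable {d : ℕ} (τ : Equiv.Perm (Fin d)) (Δ kbar : ℕ) (ε δ : ℝ) (h : Fin d → ℕ)

/-- The noisy counts without noise. -/
noncomputable def baseCount : Option (Fin d) → ℝ
  | none => botCount τ Δ kbar ε δ h
  | some i => (h i : ℝ)

theorem noisyCount_eq (g : Option (Fin d) → ℝ) :
    noisyCount τ Δ kbar ε δ h g = fun b => baseCount τ Δ kbar ε δ h b + g b := by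
  funext b
  cases b <;> rfl

theorem toFinset_noisyRanking (g : Option (Fin d) → ℝ) :
    (noisyRanking τ Δ kbar ε δ h g).toFinset = (topSet τ h kbar).insertNone := by
  ext b
  rw [noisyRanking, List.mem_toFinset, List.mem_insertionSort, Finset.mem_insertNone]
  cases b <;> simp [topSet, -List.map_take]

/-- Without ties the noisy ranking is strictly decreasing, so each peeling step with 0-1
probabilities removes its head. -/
theorem peel_eq_limitedDomain {g : Option (Fin d) → ℝ}
    (hg : Function.Injective fun b => baseCount τ Δ kbar ε δ h b + g b) (n : ℕ)
    (φ : List (Option (Fin d)) → ℝ) :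
    peel (topIndicator fun b => baseCount τ Δ kbar ε δ h b + g b) none n
      (topSet τ h kbar).insertNone φ = φ (limitedDomain τ Δ n kbar ε δ h g) := by
  have hperm : (noisyRanking τ Δ kbar ε δ h g).Perm
      (none :: ((ranking τ h).take kbar).map some) := List.perm_insertionSort _ _
  have hnone : none ∈ noisyRanking τ Δ kbar ε δ h g := hperm.mem_iff.2 (by simp)
  have hnodup : (noisyRanking τ Δ kbar ε δ h g).Nodup := by
    rw [hperm.nodup_iff, List.nodup_cons]
    exact ⟨by simp [-List.map_take], ((nodup_ranking τ h).sublist (List.take_sublist _ _)).map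
      (Option.some_injective _)⟩
  have hle : (noisyRanking τ Δ kbar ε δ h g).Pairwise fun a b =>
      noisyCount τ Δ kbar ε δ h g b ≤ noisyCount τ Δ kbar ε δ h g a := by
    have : Std.Total fun a b : Option (Fin d) =>
        noisyCount τ Δ kbar ε δ h g b ≤ noisyCount τ Δ kbar ε δ h g a :=
      ⟨fun a b => le_total _ _⟩
    have : IsTrans (Option (Fin d)) fun a b : Option (Fin d) =>
        noisyCount τ Δ kbar ε δ h g b ≤ noisyCount τ Δ kbar ε δ h g a :=
      ⟨fun a b c hab hbc => hbc.trans hab⟩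
    exact List.pairwise_insertionSort _ _
  have hlt : (noisyRanking τ Δ kbar ε δ h g).Pairwise fun a b =>
      baseCount τ Δ kbar ε δ h b + g b < baseCount τ Δ kbar ε δ h a + g a := by
    rw [noisyCount_eq] at hle
    exact (hle.and hnodup).imp fun {a b} hab => lt_of_le_of_ne hab.1 fun he => hab.2 (hg he.symm)
  rw [← toFinset_noisyRanking τ Δ kbar ε δ h g, peel_topIndicator n hlt hnone,
    ← truncateAt_none n hnone]
  rfl

variable (k dbar : ℕ)

/-- The quality scores of the candidate cutoffs. -/
noncomputable def cutoffScore (i : Finset.Icc k dbar) : ℝ :=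
  -((orderedCount τ h i : ℝ) + Real.log (((i : ℕ) : ℝ) / δ) / ε)

theorem noisyCutoff_eq {g : Finset.Icc k dbar → ℝ} {i : Finset.Icc k dbar}
    (hi : ∀ j, j ≠ i → cutoffScore τ ε δ h k dbar j + g j < cutoffScore τ ε δ h k dbar i + g i) :
    noisyCutoff τ k dbar ε δ h g = i := by
  have hset : {m : ℕ | ∃ hm : m ∈ Finset.Icc k dbar, ∀ j : Finset.Icc k dbar,
      (orderedCount τ h m : ℝ) + Real.log ((m : ℝ) / δ) / ε - g ⟨m, hm⟩ ≤
        (orderedCount τ h j : ℝ) + Real.log (((j : ℕ) : ℝ) / δ) / ε - g j} = {(i : ℕ)} := by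
    ext m
    constructor
    · rintro ⟨hm, hmin⟩
      by_contra hne
      have h1 := hi ⟨m, hm⟩ fun he => hne (congrArg Subtype.val he)
      have h2 := hmin i
      simp only [cutoffScore] at h1
      linarith
    · rintro rfl
      refine ⟨i.2, fun j => ?_⟩
      rcases eq_or_ne j i with rfl | hji
      · exact le_rfl
      · have h1 := hi j hji
        simp only [cutoffScore] at h1
        simp only [Subtype.coe_eta]
        linarith
  rw [noisyCutoff]
  simp only
  rw [hset, csInf_singleton]

end Mechanism

/-! ### The output distribution -/

section Law

variable {d : ℕ} (τ : Equiv.Perm (Fin d)) (k dbar : ℕ) (ε δ : ℝ) (h : Fin d → ℕ)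

/-- The mean of `φ` over the outputs of the optimal threshold algorithm, as an iterated sum over
the choices of exponential mechanisms. -/
noncomputable def outputMean (φ : List (Option (Fin d)) → ℝ) : ℝ :=
  ∑ i : Finset.Icc k dbar,
    gibbs (fun j => Real.exp (ε * cutoffScore τ ε δ h k dbar j)) Finset.univ i *
      peel (gibbs fun b => Real.exp (ε * baseCount τ d i ε δ h b)) none (k - 1)
        (topSet τ h i).insertNone φ

variable {ε}

/-- The case of a single draw: peeling with n = 1, tested on the list `[i]`. -/
theorem lintegral_topIndicator {ι : Type*} [Fintype ι] [DecidableEq ι] (hε : 0 < ε) (s : ι → ℝ)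
    (i : ι) :
    ∫⁻ g, ENNReal.ofReal (topIndicator (fun b => s b + g b) Finset.univ i)
      ∂Measure.pi (fun _ : ι => gumbel (1 / ε)) =
      ENNReal.ofReal (gibbs (fun b => Real.exp (ε * s b)) Finset.univ i) := by
  have hone : ∀ p : Finset ι → ι → ℝ, peel p i 1 Finset.univ
      (fun l => if l = [i] then 1 else 0) = p Finset.univ i := by
    intro p
    simp only [peel]
    rw [Finset.sum_eq_single i]
    · simp
    · intro b _ hb
      simp [hb]
    · simp
  have hl := lintegral_peel hε s i 1 Finset.univ (φ := fun l => if l = [i] then 1 else 0)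
    (fun l => by split_ifs <;> norm_num)
  simpa only [hone] using hl

/-- The output distribution of the optimal threshold algorithm. -/
theorem noiseLaw_optimalThreshold (hε : 0 < ε) (hkd : k ≤ dbar)
    (S : Set (List (Option (Fin d)))) :
    noiseLaw d k dbar ε {ω | optimalThreshold τ k dbar ε δ h ω ∈ S} =
      ENNReal.ofReal (outputMean τ k dbar ε δ h (S.indicator 1)) := by
  have hprob := isProbabilityMeasure_gumbel hε
  have hφ : ∀ l, 0 ≤ S.indicator (1 : List (Option (Fin d)) → ℝ) l :=
    fun l => Set.indicator_nonneg (fun _ _ => zero_le_one) l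
  set s0 := cutoffScore τ ε δ h k dbar with hs0
  set F : (Finset.Icc k dbar → ℝ) × (Option (Fin d) → ℝ) → ℝ := fun ω =>
    ∑ i : Finset.Icc k dbar, topIndicator (fun j => s0 j + ω.1 j) Finset.univ i *
      peel (topIndicator fun b => baseCount τ d i ε δ h b + ω.2 b) none (k - 1)
        (topSet τ h i).insertNone (S.indicator 1) with hF
  have hm1 : ∀ i, Measurable fun g : Finset.Icc k dbar → ℝ =>
      topIndicator (fun j => s0 j + g j) Finset.univ i := fun i => measurable_topIndicator _ _ _
  have hm2 : ∀ i : Finset.Icc k dbar, Measurable fun g : Option (Fin d) → ℝ =>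
      peel (topIndicator fun b => baseCount τ d i ε δ h b + g b) none (k - 1)
        (topSet τ h i).insertNone (S.indicator 1) := fun i => measurable_peel_topIndicator _ _ _ _ _
  have hFm : Measurable F := Finset.measurable_sum _ fun i _ =>
    ((hm1 i).comp measurable_fst).mul ((hm2 i).comp measurable_snd)
  have hae : ∀ᵐ ω ∂noiseLaw d k dbar ε,
      F ω = S.indicator 1 (optimalThreshold τ k dbar ε δ h ω) := by
    have h1 : ∀ᵐ ω ∂noiseLaw d k dbar ε, Function.Injective fun j => s0 j + ω.1 j :=
      Measure.quasiMeasurePreserving_fst.ae (ae_injective hε s0)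
    have h2 : ∀ᵐ ω ∂noiseLaw d k dbar ε, ∀ i : Finset.Icc k dbar,
        Function.Injective fun b => baseCount τ d i ε δ h b + ω.2 b := by
      rw [ae_all_iff]
      exact fun i => Measure.quasiMeasurePreserving_snd.ae (ae_injective hε _)
    filter_upwards [h1, h2] with ω hω1 hω2
    have hne : (Finset.univ : Finset (Finset.Icc k dbar)).Nonempty :=
      ⟨⟨k, Finset.mem_Icc.2 ⟨le_rfl, hkd⟩⟩, Finset.mem_univ _⟩
    obtain ⟨i, -, hi⟩ := Finset.exists_max_image Finset.univ (fun j => s0 j + ω.1 j) hne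
    have hlt : ∀ j, j ≠ i → s0 j + ω.1 j < s0 i + ω.1 i := fun j hj =>
      lt_of_le_of_ne (hi j (Finset.mem_univ j)) fun he => hj (hω1 he)
    have hcut := noisyCutoff_eq τ ε δ h k dbar (g := ω.1) hlt
    rw [hF]
    simp only
    rw [Finset.sum_eq_single i]
    · rw [topIndicator, if_pos fun b hb => hlt b (Finset.ne_of_mem_erase hb), one_mul,
        peel_eq_limitedDomain τ d i ε δ h (hω2 i), optimalThreshold, hcut]
    · intro j _ hji
      rw [topIndicator, if_neg, zero_mul]
      intro hj
      exact lt_asymm (hlt j hji) (hj i (Finset.mem_erase.2 ⟨hji.symm, Finset.mem_univ _⟩))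
    · simp
  have hmeas : noiseLaw d k dbar ε {ω | optimalThreshold τ k dbar ε δ h ω ∈ S} =
      ∫⁻ ω, ENNReal.ofReal (F ω) ∂noiseLaw d k dbar ε := by
    -- The output event is not known to be measurable, but it agrees almost everywhere with this
    -- set.
    have hT : MeasurableSet {ω | F ω = 1} := hFm (measurableSet_singleton 1)
    have hET : {ω | optimalThreshold τ k dbar ε δ h ω ∈ S} =ᵐ[noiseLaw d k dbar ε]
        {ω | F ω = 1} := by
      filter_upwards [hae] with ω hω
      by_cases hS : optimalThreshold τ k dbar ε δ h ω ∈ S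
      · rw [Set.indicator_of_mem hS] at hω
        exact propext ⟨fun _ => hω, fun _ => hS⟩
      · rw [Set.indicator_of_notMem hS] at hω
        refine propext ⟨fun hm => absurd hm hS, fun hm => ?_⟩
        have : F ω = 1 := hm
        rw [hω] at this
        exact absurd this zero_ne_one
    rw [measure_congr hET, ← lintegral_indicator_one hT]
    refine lintegral_congr_ae ?_
    filter_upwards [hae] with ω hω
    by_cases hS : optimalThreshold τ k dbar ε δ h ω ∈ S
    · rw [Set.indicator_of_mem hS] at hω
      have hω' : F ω = 1 := hω
      rw [Set.indicator_of_mem (show ω ∈ {ω | F ω = 1} from hω'), hω']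
      simp
    · rw [Set.indicator_of_notMem hS] at hω
      rw [Set.indicator_of_notMem, hω]
      · simp
      · intro hm
        have : F ω = 1 := hm
        rw [hω] at this
        exact absurd this zero_ne_one
  have hpeel0 : ∀ (i : Finset.Icc k dbar) (g : Option (Fin d) → ℝ),
      0 ≤ peel (topIndicator fun b => baseCount τ d i ε δ h b + g b) none (k - 1)
        (topSet τ h i).insertNone (S.indicator 1) :=
    fun i g => peel_nonneg (topIndicator_nonneg _) _ _ hφ
  rw [hmeas, outputMean, ENNReal.ofReal_sum_of_nonneg]
  · simp only [hF]
    simp only [ENNReal.ofReal_sum_of_nonneg fun i _ =>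
      mul_nonneg (topIndicator_nonneg _ _ _) (hpeel0 i _)]
    rw [lintegral_finsetSum]
    swap
    · exact fun i _ => ENNReal.measurable_ofReal.comp
        (((hm1 i).comp measurable_fst).mul ((hm2 i).comp measurable_snd))
    refine Finset.sum_congr rfl fun i _ => ?_
    simp only [ENNReal.ofReal_mul (topIndicator_nonneg _ _ _)]
    rw [noiseLaw, lintegral_prod_mul (hm1 i).ennreal_ofReal.aemeasurable
      (hm2 i).ennreal_ofReal.aemeasurable, lintegral_topIndicator hε, lintegral_peel hε _ _ _ _ hφ,
      ENNReal.ofReal_mul (gibbs_nonneg (fun _ => Real.exp_pos _) _)]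
  · exact fun i _ => mul_nonneg (gibbs_nonneg (fun _ => Real.exp_pos _) _)
      (peel_nonneg (fun A a => gibbs_nonneg (fun _ => Real.exp_pos _) a) _ _ hφ)

end Law

/-! ### Comparison of neighboring datasets -/

section Privacy

theorem rangeBounded_exp {ι : Type*} {A : Finset ι} {s s' : ι → ℝ} {c ε : ℝ} (hε : 0 < ε)
    (h : ∀ a ∈ A, c ≤ s' a - s a ∧ s' a - s a ≤ c + 1) :
    RangeBounded A (fun a => Real.exp (ε * s a)) (fun a => Real.exp (ε * s' a)) (ε * c) ε := by
  intro a ha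
  have := h a ha
  rw [← Real.exp_add, ← Real.exp_add, Real.exp_le_exp, Real.exp_le_exp]
  constructor <;> nlinarith

variable {d : ℕ} {τ : Equiv.Perm (Fin d)} {ε δ : ℝ} {h h' : Fin d → ℕ}

/-- The relation between neighboring histograms, with `c = 0` or `c = -1` for the direction. -/
def CountsWithin (c : ℝ) (h h' : Fin d → ℕ) : Prop :=
  (c = 0 ∧ (∀ i, h i ≤ h' i) ∧ ∀ i, h' i ≤ h i + 1) ∨
    (c = -1 ∧ (∀ i, h' i ≤ h i) ∧ ∀ i, h i ≤ h' i + 1)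

theorem Neighbors.exists_countsWithin {x y : Dataset d} (hxy : Neighbors x y) :
    ∃ c, CountsWithin c (histogram x) (histogram y) := by
  have key : ∀ (u : Finset (Fin d)) (x : Dataset d) i, histogram x i ≤ histogram (u ::ₘ x) i ∧
      histogram (u ::ₘ x) i ≤ histogram x i + 1 := by
    intro u x i
    simp only [histogram, Multiset.countP_cons]
    split_ifs <;> omega
  obtain ⟨u, rfl | rfl⟩ := hxy
  · exact ⟨-1, Or.inr ⟨rfl, fun i => (key u y i).1, fun i => (key u y i).2⟩⟩
  · exact ⟨0, Or.inl ⟨rfl, fun i => (key u x i).1, fun i => (key u x i).2⟩⟩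

theorem CountsWithin.orderedCount_sub {c : ℝ} (hc : CountsWithin c h h') {j : ℕ} (hj : 0 < j) :
    c ≤ (orderedCount τ h' j : ℝ) - orderedCount τ h j ∧
      (orderedCount τ h' j : ℝ) - orderedCount τ h j ≤ c + 1 := by
  obtain ⟨rfl, h1, h2⟩ | ⟨rfl, h1, h2⟩ := hc
  · have e1 : (orderedCount τ h j : ℝ) ≤ orderedCount τ h' j :=
      Nat.cast_le.2 (orderedCount_mono h1 hj)
    have e2 : (orderedCount τ h' j : ℝ) ≤ orderedCount τ h j + 1 := by
      exact_mod_cast orderedCount_le_add_one h2 hj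
    constructor <;> linarith
  · have e1 : (orderedCount τ h' j : ℝ) ≤ orderedCount τ h j :=
      Nat.cast_le.2 (orderedCount_mono h1 hj)
    have e2 : (orderedCount τ h j : ℝ) ≤ orderedCount τ h' j + 1 := by
      exact_mod_cast orderedCount_le_add_one h2 hj
    constructor <;> linarith

/-- The score is minus a count, so the interval [c, c + 1] of count changes is reflected to [-1 - c,
-c]. Its length, the only thing that composition uses, is unchanged. -/
theorem CountsWithin.rangeBounded_cutoffScore {c : ℝ} (hε : 0 < ε) (hc : CountsWithin c h h')
    {k dbar : ℕ} (hk : 1 ≤ k) :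
    RangeBounded Finset.univ (fun j => Real.exp (ε * cutoffScore τ ε δ h k dbar j))
      (fun j => Real.exp (ε * cutoffScore τ ε δ h' k dbar j)) (ε * (-1 - c)) ε := by
  refine rangeBounded_exp hε fun j _ => ?_
  have := hc.orderedCount_sub (τ := τ) (hk.trans (Finset.mem_Icc.1 j.2).1)
  simp only [cutoffScore]
  constructor <;> linarith

/-- The limited domains of neighboring histograms are matched by a permutation that is the
identity on common elements, and counts of moved elements are close to the threshold. -/
theorem CountsWithin.exists_perm {c : ℝ} (hc : CountsWithin c h h') {m : ℕ} (hm : m ≤ d) :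
    ∃ σ : Equiv.Perm (Fin d), (topSet τ h m).map σ.toEmbedding = topSet τ h' m ∧
      (∀ i ∈ topSet τ h m, c ≤ (h' (σ i) : ℝ) - h i ∧ (h' (σ i) : ℝ) - h i ≤ c + 1) ∧
      ∀ i ∈ topSet τ h m, σ i ≠ i → h i ≤ orderedCount τ h (m + 1) + 1 := by
  obtain ⟨σ, hσ, hfix⟩ := exists_perm_map_eq
    ((card_topSet τ h hm).trans (card_topSet τ h' hm).symm)
  have hmem : ∀ i ∈ topSet τ h m, σ i ∈ topSet τ h' m := fun i hi =>
    hσ ▸ Finset.mem_map_of_mem σ.toEmbedding hi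
  -- If `σ i` were in the first top set it would be a common element, hence fixed, and injectivity
  -- would give σ i = i. So h (σ i) is at most the threshold count, and h i exceeds h (σ i) by at
  -- most 1.
  have hout : ∀ i ∈ topSet τ h m, σ i ≠ i → h (σ i) ≤ orderedCount τ h (m + 1) := by
    intro i hi hne
    refine le_orderedCount_of_notMem τ h hm fun hmem' => hne ?_
    exact σ.injective (hfix _ hmem' (hmem i hi))
  refine ⟨σ, hσ, ?_⟩
  obtain ⟨rfl, h1, h2⟩ | ⟨rfl, h1, h2⟩ := hc
  · have hcount := fun i hi => count_le_count_map h1 h2 hσ hfix (i := i) hi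
    refine ⟨fun i hi => ?_, fun i hi hne => ?_⟩
    · have e1 : (h i : ℝ) ≤ h' (σ i) := Nat.cast_le.2 (hcount i hi).1
      have e2 : (h' (σ i) : ℝ) ≤ h i + 1 := by exact_mod_cast (hcount i hi).2
      constructor <;> linarith
    · have := hcount i hi
      have := h2 (σ i)
      have := hout i hi hne
      omega
  · have hσ' : (topSet τ h' m).map σ.symm.toEmbedding = topSet τ h m := by
      rw [← hσ, Finset.map_map]
      ext a
      simp
    have hfix' : ∀ a ∈ topSet τ h' m, a ∈ topSet τ h m → σ.symm a = a := by
      intro a ha' ha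
      rw [Equiv.symm_apply_eq, hfix a ha ha']
    have hcount : ∀ i ∈ topSet τ h m, h' (σ i) ≤ h i ∧ h i ≤ h' (σ i) + 1 := by
      intro i hi
      simpa using count_le_count_map h1 h2 hσ' hfix' (hmem i hi)
    refine ⟨fun i hi => ?_, fun i hi hne => ?_⟩
    · have e1 : (h' (σ i) : ℝ) ≤ h i := Nat.cast_le.2 (hcount i hi).1
      have e2 : (h i : ℝ) ≤ h' (σ i) + 1 := by exact_mod_cast (hcount i hi).2
      constructor <;> linarith
    · have := hcount i hi
      have := h1 (σ i)
      have := hout i hi hne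
      omega

/-- The summed function counts the moved elements in the output, so it dominates the indicator of
the bad event. Each of the at most `m` terms has mean at most δ/m. -/
theorem peel_bad_le (hε : 0 < ε) (hδ : 0 < δ) {m : ℕ} (hm1 : 1 ≤ m) (hm : m ≤ d)
    {σ : Equiv.Perm (Fin d)}
    (hbad : ∀ i ∈ topSet τ h m, σ i ≠ i → h i ≤ orderedCount τ h (m + 1) + 1) (n : ℕ) :
    peel (gibbs fun b => Real.exp (ε * baseCount τ d m ε δ h b)) none n (topSet τ h m).insertNone
      (fun l => ∑ i ∈ (topSet τ h m).filter (fun i => σ i ≠ i), if some i ∈ l then 1 else 0) ≤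
      δ := by
  have hm0 : (0 : ℝ) < m := by exact_mod_cast hm1
  have hw : ∀ b, 0 < Real.exp (ε * baseCount τ d m ε δ h b) := fun b => Real.exp_pos _
  rw [peel_sum]
  have hterm : ∀ i ∈ (topSet τ h m).filter (fun i => σ i ≠ i),
      peel (gibbs fun b => Real.exp (ε * baseCount τ d m ε δ h b)) none n
        (topSet τ h m).insertNone (fun l => if some i ∈ l then 1 else 0) ≤ δ / m := by
    intro i hi
    rw [Finset.mem_filter] at hi
    have hpeel := peel_gibbs_mem_le hw (a := some i) (z := none) (by simp) n
      (A := (topSet τ h m).insertNone) (by simpa using hi.1) (by simp)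
    refine le_trans (le_of_eq ?_) (hpeel.trans ?_)
    · congr!
    have hi' : (h i : ℝ) ≤ orderedCount τ h (m + 1) + 1 := by exact_mod_cast hbad i hi.1 hi.2
    -- The logarithmic offset multiplies the weight of ⊥ by m/δ, while the +1 absorbs the excess of
    -- a moved element. The sensitivity bound is d ≥ m, so the minimum in the offset is `m`.
    have hbot : Real.exp (ε * baseCount τ d m ε δ h none) =
        Real.exp (ε * (orderedCount τ h (m + 1) + 1)) * (m / δ) := by
      rw [baseCount, botCount, min_eq_right hm, mul_add, Real.exp_add, mul_div_cancel₀ _ hε.ne',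
        Real.exp_log (div_pos hm0 hδ)]
    have htop : Real.exp (ε * baseCount τ d m ε δ h (some i)) ≤
        Real.exp (ε * (orderedCount τ h (m + 1) + 1)) :=
      Real.exp_le_exp.2 (mul_le_mul_of_nonneg_left hi' hε.le)
    rw [div_le_div_iff₀ (add_pos (hw _) (hw _)) hm0, hbot]
    have h3 : δ * (Real.exp (ε * (orderedCount τ h (m + 1) + 1)) * (m / δ)) =
        Real.exp (ε * (orderedCount τ h (m + 1) + 1)) * m := by field_simp
    have h4 := mul_le_mul_of_nonneg_right htop hm0.le
    have h5 := mul_pos hδ (hw (some i))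
    rw [mul_add, h3]
    linarith
  refine (Finset.sum_le_card_nsmul _ _ _ hterm).trans ?_
  rw [nsmul_eq_mul]
  have hcard : (((topSet τ h m).filter fun i => σ i ≠ i).card : ℝ) ≤ m := by
    exact_mod_cast (Finset.card_filter_le _ _).trans (card_topSet τ h hm).le
  refine (mul_le_mul_of_nonneg_right hcard (div_pos hδ hm0).le).trans (le_of_eq ?_)
  field_simp

/-- For a fixed cutoff, the output of the limited domain algorithm is, up to a bad event of
probability `δ`, the outcome of a range-bounded peeling process on a common domain. -/
theorem CountsWithin.exists_coupling {c : ℝ} (hε : 0 < ε) (hδ : 0 < δ) (hc : CountsWithin c h h')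
    {m : ℕ} (hm1 : 1 ≤ m) (hm : m ≤ d) (n : ℕ) (S : Set (List (Option (Fin d)))) :
    ∃ (u : Option (Fin d) → ℝ) (φ : List (Option (Fin d)) → ℝ), (∀ a, 0 < u a) ∧
      (∀ l, 0 ≤ φ l) ∧ (∀ l, φ l ≤ 1) ∧
      RangeBounded (topSet τ h m).insertNone
        (fun b => Real.exp (ε * baseCount τ d m ε δ h b)) u (ε * c) ε ∧
      peel (gibbs fun b => Real.exp (ε * baseCount τ d m ε δ h b)) none n
        (topSet τ h m).insertNone (S.indicator 1) ≤ δ +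
        peel (gibbs fun b => Real.exp (ε * baseCount τ d m ε δ h b)) none n
          (topSet τ h m).insertNone φ ∧
      peel (gibbs u) none n (topSet τ h m).insertNone φ ≤
        peel (gibbs fun b => Real.exp (ε * baseCount τ d m ε δ h' b)) none n
          (topSet τ h' m).insertNone (S.indicator 1) := by
  classical
  obtain ⟨σ, hσ, hdiff, hbad⟩ := hc.exists_perm (τ := τ) hm
  set ρ : Equiv.Perm (Option (Fin d)) := σ.optionCongr with hρ
  have hS0 : ∀ l, 0 ≤ S.indicator (1 : List (Option (Fin d)) → ℝ) l :=
    fun l => Set.indicator_nonneg (fun _ _ => zero_le_one) l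
  have hS1 : ∀ l, S.indicator (1 : List (Option (Fin d)) → ℝ) l ≤ 1 :=
    fun l => Set.indicator_le_self' (fun _ _ => zero_le_one) l
  -- The weights of the second dataset are pulled back to the domain of the first, and the test
  -- function keeps only lists fixed entrywise by `ρ`, on which the relabelling is invisible.
  refine ⟨(fun b => Real.exp (ε * baseCount τ d m ε δ h' b)) ∘ ρ,
    fun l => if ∀ a ∈ l, ρ a = a then S.indicator 1 l else 0, fun a => Real.exp_pos _,
    fun l => ?_, fun l => ?_, ?_, ?_, ?_⟩
  · beta_reduce
    split_ifs
    · exact hS0 l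
    · exact le_rfl
  · beta_reduce
    split_ifs
    · exact hS1 l
    · exact zero_le_one
  · refine rangeBounded_exp (s' := fun b => baseCount τ d m ε δ h' (ρ b)) hε fun a ha => ?_
    cases a with
    | none =>
      have := hc.orderedCount_sub (τ := τ) (Nat.succ_pos m)
      simp only [hρ, Equiv.optionCongr_apply, Option.map_none, baseCount, botCount]
      constructor <;> linarith
    | some i => exact hdiff i (by simpa using ha)
  · refine le_trans ?_ (add_le_add_left (peel_bad_le hε hδ hm1 hm hbad n) _)
    rw [← peel_add]
    refine peel_mono (fun A a => gibbs_nonneg (fun _ => Real.exp_pos _) a) _ _ fun l hl => ?_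
    have hsum0 : ∀ i ∈ (topSet τ h m).filter (fun i => σ i ≠ i),
        (0 : ℝ) ≤ if some i ∈ l then 1 else 0 := fun i _ => by split_ifs <;> norm_num
    by_cases hgood : ∀ a ∈ l, ρ a = a
    · rw [if_pos hgood]
      exact le_add_of_nonneg_left (Finset.sum_nonneg hsum0)
    · rw [if_neg hgood, add_zero]
      push Not at hgood
      obtain ⟨a, hal, hane⟩ := hgood
      cases a with
      | none => exact absurd rfl hane
      | some i =>
        have hi : i ∈ topSet τ h m := by simpa using hl _ hal
        have hσi : σ i ≠ i := fun he => hane (by simp [hρ, he])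
        refine (hS1 l).trans ?_
        refine le_trans ?_ (Finset.single_le_sum hsum0 (Finset.mem_filter.2 ⟨hi, hσi⟩))
        rw [if_pos hal]
  · have hmap : (topSet τ h' m).insertNone = (topSet τ h m).insertNone.map ρ.toEmbedding := by
      ext a
      rw [Finset.mem_map_equiv, ← hσ]
      cases a <;> simp [hρ, ← Equiv.optionCongr_symm, Finset.mem_map_equiv]
    rw [hmap, peel_gibbs_map ρ (by simp [hρ])]
    refine peel_mono (fun A a => gibbs_nonneg (fun _ => Real.exp_pos _) a) _ _ fun l _ => ?_
    split_ifs with hgood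
    · rw [List.map_congr_left (g := id) hgood, List.map_id]
    · exact hS0 _

theorem outputMean_le_of_step {k dbar : ℕ} (hk : 1 ≤ k) (hkd : k ≤ dbar) (hd : dbar ≤ d)
    (hε : 0 < ε) (hδ : 0 < δ) {c : ℝ} (hc : CountsWithin c h h')
    (S : Set (List (Option (Fin d)))) :
    outputMean τ k dbar ε δ h (S.indicator 1) ≤
        δ + Real.exp (k * ε) * outputMean τ k dbar ε δ h' (S.indicator 1) ∧
      ∀ l, 0 ≤ l → ∀ t, outputMean τ k dbar ε δ h (S.indicator 1) ≤
        δ + (Real.exp t * outputMean τ k dbar ε δ h' (S.indicator 1) + Real.exp (-l * t) *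
          Real.exp (l * (ε * ((Real.exp ε - 1) / (Real.exp ε + 1))) + l ^ 2 * ε ^ 2 / 8) ^ k) := by
  have hmem := fun i : Finset.Icc k dbar => Finset.mem_Icc.1 i.2
  choose u φ hu hφ hφ1 hrange hup hlow using fun i : Finset.Icc k dbar =>
    hc.exists_coupling (τ := τ) hε hδ (hk.trans (hmem i).1) ((hmem i).2.trans hd) (k - 1) S
  have hcut := hc.rangeBounded_cutoffScore (τ := τ) (δ := δ) (dbar := dbar) hε hk
  have hw : ∀ (s : Option (Fin d) → ℝ) b, 0 < Real.exp (ε * s b) := fun s b => Real.exp_pos _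
  have hv : ∀ (s : Finset.Icc k dbar → ℝ) b, 0 < Real.exp (ε * s b) := fun s b => Real.exp_pos _
  have hne : (Finset.univ : Finset (Finset.Icc k dbar)).Nonempty :=
    ⟨⟨k, Finset.mem_Icc.2 ⟨le_rfl, hkd⟩⟩, Finset.mem_univ _⟩
  -- The choice of the cutoff is one step and the limited domain algorithm contributes `n` more,
  -- which accounts for `k` in total.
  obtain ⟨n, rfl⟩ : ∃ n, k = n + 1 := ⟨k - 1, by omega⟩
  simp only [Nat.add_sub_cancel] at hup hlow
  set f : Finset.Icc (n + 1) dbar → ℝ := fun i =>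
    peel (gibbs fun b => Real.exp (ε * baseCount τ d i ε δ h b)) none n
      (topSet τ h i).insertNone (φ i) with hf
  set g : Finset.Icc (n + 1) dbar → ℝ := fun i =>
    peel (gibbs (u i)) none n (topSet τ h i).insertNone (φ i) with hg
  have hbound : outputMean τ (n + 1) dbar ε δ h (S.indicator 1) ≤ δ + ∑ i,
      gibbs (fun j => Real.exp (ε * cutoffScore τ ε δ h (n + 1) dbar j)) Finset.univ i * f i := by
    calc outputMean τ (n + 1) dbar ε δ h (S.indicator 1)
        ≤ ∑ i, gibbs (fun j => Real.exp (ε * cutoffScore τ ε δ h (n + 1) dbar j)) Finset.univ i *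
            (δ + f i) :=
          Finset.sum_le_sum fun i _ => mul_le_mul_of_nonneg_left (hup i) (gibbs_nonneg (hv _) i)
      _ = _ := by
          simp only [mul_add]
          rw [Finset.sum_add_distrib, ← Finset.sum_mul, sum_gibbs (hv _) hne, one_mul]
  have hlower : ∑ i, gibbs (fun j => Real.exp (ε * cutoffScore τ ε δ h' (n + 1) dbar j))
      Finset.univ i * g i ≤ outputMean τ (n + 1) dbar ε δ h' (S.indicator 1) :=
    Finset.sum_le_sum fun i _ => mul_le_mul_of_nonneg_left (hlow i) (gibbs_nonneg (hv _) i)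
  constructor
  · refine hbound.trans (add_le_add_right ?_ δ)
    refine le_trans ?_ (mul_le_mul_of_nonneg_left hlower (Real.exp_pos _).le)
    rw [Finset.mul_sum]
    refine Finset.sum_le_sum fun i hi => ?_
    have hstep := peel_gibbs_le_pure (z := none) (hw _) (hu i) hε n (hrange i) (hφ i)
    have hf0 : 0 ≤ f i := peel_nonneg (fun A a => gibbs_nonneg (hw _) a) _ _ (hφ i)
    refine (mul_le_mul (hcut.gibbs_le (hv _) (hv _) hi) hstep hf0
      (mul_nonneg (Real.exp_pos _).le (gibbs_nonneg (hv _) i))).trans (le_of_eq ?_)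
    push_cast
    rw [add_mul, one_mul, Real.exp_add]
    ring
  · intro l hl t
    refine hbound.trans (add_le_add_right ?_ δ)
    have hstep := hcut.sum_gibbs_mul_le hε (hv _) (hv _) hne hl (f := f) (g := g)
      (pow_nonneg (Real.exp_pos _).le n) (fun i _ t =>
        peel_gibbs_le (hw _) (hu i) hε hl n (hrange i) (hφ i) (hφ1 i) t) t
    rw [pow_succ]
    exact hstep.trans (add_le_add_left (mul_le_mul_of_nonneg_left hlower (Real.exp_pos _).le) _)

/-- After clearing denominators, the difference x (exp x + 1) - 2 (exp x - 1) vanishes at 0 and has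
derivative 1 - (1 - x) exp x, which is nonnegative because 1 - x ≤ exp(-x). -/
theorem exp_sub_one_div_exp_add_one_le {x : ℝ} (hx : 0 ≤ x) :
    (Real.exp x - 1) / (Real.exp x + 1) ≤ x / 2 := by
  have hder : ∀ y : ℝ, HasDerivAt (fun y => y * (Real.exp y + 1) - 2 * (Real.exp y - 1))
      (1 * (Real.exp y + 1) + y * Real.exp y - 2 * Real.exp y) y := by
    intro y
    exact ((hasDerivAt_id y).mul ((Real.hasDerivAt_exp y).add_const 1)).sub
      (((Real.hasDerivAt_exp y).sub_const 1).const_mul 2)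
  have hmono : Monotone fun y => y * (Real.exp y + 1) - 2 * (Real.exp y - 1) := by
    refine monotone_of_deriv_nonneg (fun y => (hder y).differentiableAt) fun y => ?_
    rw [(hder y).deriv]
    have h1 := mul_le_mul_of_nonneg_right (Real.add_one_le_exp (-y)) (Real.exp_pos y).le
    rw [← Real.exp_add, neg_add_cancel, Real.exp_zero] at h1
    linarith
  have := hmono hx
  simp only [zero_mul, Real.exp_zero, sub_self, mul_zero] at this
  rw [div_le_div_iff₀ (by positivity) two_pos]
  linarith

/-- A common lower bound for the two advanced composition bounds. -/
theorem exp_tail_le_of_composition {k : ℕ} (hk : 1 ≤ k) (hε : 0 < ε) {δ' : ℝ} (hδ' : 0 < δ')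
    (hδ1 : δ' ≤ 1) : ∃ l, 0 ≤ l ∧ ∃ t,
      t ≤ k * ε * ((Real.exp ε - 1) / (Real.exp ε + 1)) +
        ε * √(2 * k * Real.log (1 / δ')) ∧
      t ≤ k * ε ^ 2 / 2 + ε * √(1 / 2 * k * Real.log (1 / δ')) ∧
      Real.exp (-l * t) * Real.exp (l * (ε * ((Real.exp ε - 1) / (Real.exp ε + 1))) +
        l ^ 2 * ε ^ 2 / 8) ^ k = δ' := by
  have hk0 : (0 : ℝ) < k := by exact_mod_cast hk
  have hL : 0 ≤ Real.log (1 / δ') := Real.log_nonneg (by rw [le_div_iff₀ hδ']; linarith)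
  set r := √(1 / 2 * k * Real.log (1 / δ')) with hr
  have hr0 : 0 ≤ r := Real.sqrt_nonneg _
  have hr2 : r ^ 2 = 1 / 2 * k * Real.log (1 / δ') := Real.sq_sqrt (by positivity)
  -- With t exceeding k times the mean bound by εr, the exponent is -lεr + k l² ε²/8. This `l`
  -- minimizes it, with value -2r²/k = log δ'.
  refine ⟨4 * r / (k * ε), by positivity,
    k * ε * ((Real.exp ε - 1) / (Real.exp ε + 1)) + ε * r, ?_, ?_, ?_⟩
  · have : r ≤ √(2 * k * Real.log (1 / δ')) := by
      refine Real.sqrt_le_sqrt ?_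
      have : 0 ≤ k * Real.log (1 / δ') := by positivity
      linarith
    have := mul_le_mul_of_nonneg_left this hε.le
    linarith
  · have := mul_le_mul_of_nonneg_left (exp_sub_one_div_exp_add_one_le hε.le)
      (mul_pos hk0 hε).le
    have h2 : (k : ℝ) * ε * (ε / 2) = k * ε ^ 2 / 2 := by ring
    linarith
  · rw [← Real.exp_nat_mul, ← Real.exp_add]
    have : -(4 * r / (k * ε)) * (k * ε * ((Real.exp ε - 1) / (Real.exp ε + 1)) + ε * r) +
        k * (4 * r / (k * ε) * (ε * ((Real.exp ε - 1) / (Real.exp ε + 1))) +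
          (4 * r / (k * ε)) ^ 2 * ε ^ 2 / 8) = -(2 / k * r ^ 2) := by
      generalize (Real.exp ε - 1) / (Real.exp ε + 1) = q
      field_simp
      ring
    rw [this, hr2]
    have h2 : -(2 / (k : ℝ) * (1 / 2 * k * Real.log (1 / δ'))) = Real.log δ' := by
      rw [one_div δ', Real.log_inv]
      field_simp
    rw [h2, Real.exp_log hδ']

theorem outputMean_le_composedEps {k dbar : ℕ} (hk : 1 ≤ k) (hkd : k ≤ dbar) (hd : dbar ≤ d)
    (hε : 0 < ε) (hδ : 0 < δ) {δ' : ℝ} (hδ' : 0 ≤ δ') (hδ1 : δ' ≤ 1) {c : ℝ}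
    (hc : CountsWithin c h h') (S : Set (List (Option (Fin d)))) :
    outputMean τ k dbar ε δ h (S.indicator 1) ≤
      Real.exp (composedEps k ε δ') * outputMean τ k dbar ε δ h' (S.indicator 1) + (δ + δ') := by
  obtain ⟨hpure, hadv⟩ := outputMean_le_of_step (τ := τ) hk hkd hd hε hδ hc S
  have hV : 0 ≤ outputMean τ k dbar ε δ h' (S.indicator 1) :=
    Finset.sum_nonneg fun i _ => mul_nonneg (gibbs_nonneg (fun _ => Real.exp_pos _) _)
      (peel_nonneg (fun A a => gibbs_nonneg (fun _ => Real.exp_pos _) a) _ _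
        fun l => Set.indicator_nonneg (fun _ _ => zero_le_one) l)
  have hadv' : ∀ e, (δ' ≠ 0 →
      (e = k * ε * ((Real.exp ε - 1) / (Real.exp ε + 1)) + ε * √(2 * k * Real.log (1 / δ')) ∨
      e = k * ε ^ 2 / 2 + ε * √(1 / 2 * k * Real.log (1 / δ')))) → δ' ≠ 0 →
      outputMean τ k dbar ε δ h (S.indicator 1) ≤
        Real.exp e * outputMean τ k dbar ε δ h' (S.indicator 1) + (δ + δ') := by
    intro e he h0
    obtain ⟨l, hl, t, ht1, ht2, heq⟩ :=
      exp_tail_le_of_composition hk hε (lt_of_le_of_ne hδ' (Ne.symm h0)) hδ1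
    have hte : t ≤ e := by rcases he h0 with rfl | rfl <;> assumption
    have h1 := hadv l hl t
    rw [heq] at h1
    have h2 := mul_le_mul_of_nonneg_right (Real.exp_le_exp.2 hte) hV
    linarith
  rw [composedEps]
  split_ifs with h0
  · linarith
  · rcases min_choice ((k : ℝ) * ε) (min
      (k * ε * ((Real.exp ε - 1) / (Real.exp ε + 1)) + ε * √(2 * k * Real.log (1 / δ')))
      (k * ε ^ 2 / 2 + ε * √(1 / 2 * k * Real.log (1 / δ')))) with hmin | hmin <;> rw [hmin]
    · linarith
    · rcases min_choice
        (k * ε * ((Real.exp ε - 1) / (Real.exp ε + 1)) + ε * √(2 * k * Real.log (1 / δ')))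
        (k * ε ^ 2 / 2 + ε * √(1 / 2 * k * Real.log (1 / δ'))) with hm | hm <;> rw [hm]
      · exact hadv' _ (fun _ => Or.inl rfl) h0
      · exact hadv' _ (fun _ => Or.inr rfl) h0

end Privacy

end TopKDP

theorem mainTheorem9 {d : ℕ} (τ : Equiv.Perm (Fin d)) (k dbar : ℕ) (hk : 1 ≤ k)
    (hkd : k ≤ dbar) (hd : dbar ≤ d) (ε δ δ' : ℝ) (hε : 0 < ε) (hδ : 0 < δ) (hδ' : 0 ≤ δ') :
    TopKDP.IsDifferentiallyPrivate (TopKDP.noiseLaw d k dbar ε)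
      (fun x : TopKDP.Dataset d =>
        TopKDP.optimalThreshold τ k dbar ε δ (TopKDP.histogram x))
      (TopKDP.composedEps k ε δ') (δ + δ') := by
  intro x y hxy S
  rcases le_total δ' 1 with hδ1 | hδ1
  · obtain ⟨c, hc⟩ := hxy.exists_countsWithin
    rw [TopKDP.noiseLaw_optimalThreshold τ k dbar δ _ hε hkd,
      TopKDP.noiseLaw_optimalThreshold τ k dbar δ _ hε hkd,
      ← ENNReal.ofReal_mul (Real.exp_pos _).le]
    refine (ENNReal.ofReal_le_ofReal
      (TopKDP.outputMean_le_composedEps hk hkd hd hε hδ hδ' hδ1 hc S)).trans ?_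
    exact ENNReal.ofReal_add_le
  -- For δ' ≥ 1 the additive term alone exceeds every probability.
  · have := TopKDP.isProbabilityMeasure_gumbel hε
    have hP : IsProbabilityMeasure (TopKDP.noiseLaw d k dbar ε) := by
      unfold TopKDP.noiseLaw
      infer_instance
    refine prob_le_one.trans (le_add_left ?_)
    rw [ENNReal.one_le_ofReal]
    linarith
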